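/- Let $n=p_1\cdots p_k$ be a positive square-free integer all of whose prime factors satisfy $p_i\equiv 1\pmod 4$. Let $K=\mathbb Q(\sqrt{-n})$, let $D=-4n$ be its discriminant, $\mathcal O_K$ its ring of integers, and $\mathcal A$ its ideal class group, written additively. For a prime $p$ and an integer $a$ prime to $p$, let $\left[\frac ap\right]\in\mathbb F_2$ be $0$ if the Legendre symbol $\left(\frac ap\right)$ is $1$, and $1$ otherwise. Put $p_{k+1}=2$, and let $R=(r_{ij})$ be the Rédei matrix of $K$: the $k\times(k+1)$ matrix over $\mathbb F_2$ with $$r_{ii}=\left[\frac{D/p_i^*}{p_i}\right],\qquad r_{ij}=\left[\frac{p_j}{p_i}\right]\ (i\ne j),\qquad p_i^*=(-1)^{(p_i-1)/2}p_i .$$ Let $\mathcal D(K)$ be the set of positive square-free divisors of $D$, with the group law $m_1\odot m_2=m_1m_2/\gcd(m_1,m_2)^2$. For $m\in\mathcal D(K)$ let $\mathfrak d_m=(m,\,n+\sqrt{-n})\subseteq\mathcal O_K$; this is the ideal of norm $m$ with $\mathfrak d_m^2=(m)$. For $i=1,2$ let $r_i\in\{0,1\}$ and $d_i\mid n$ be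 such that $2^{r_i}d_i\in\mathcal D(K)\cap N_{K/\mathbb Q}(K^\times)$. Write $2^rd=2^{r_1}d_1\odot 2^{r_2}d_2$ with $d\mid n$ and $r\in\{0,1\}$. Let $(x,y,z)=(a_i,b_i,c_i)$ be a solution in positive integers with $\gcd(a_i,b_i,c_i)=1$ of $$2^{r_i}z^2=d_ix^2+\frac n{d_i}y^2,$$ and put $C_i=\left(\left[\frac{c_i}{p_1}\right],\dots,\left[\frac{c_i}{p_k}\right]\right)^T\in\mathbb F_2^k$. Then $$[\mathfrak d_{2^rd}]\in 4\mathcal A\iff C_1+C_2\in\operatorname{Im}R .$$ -/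

import Mathlib

namespace RedeiClass

/-- The additive Legendre symbol with values in `𝔽₂`: for a prime `p` and an integer `a` coprime
to `p`, it is `0` if the Legendre symbol `(a/p)` is `1`, and `1` otherwise.  For prime `p` the
Jacobi symbol used here is the Legendre symbol, see `addLegendre_eq`. -/
def addLegendre (a : ℤ) (p : ℕ) : ZMod 2 :=
  if jacobiSym a p = 1 then 0 else 1

theorem addLegendre_eq (a : ℤ) (p : ℕ) [Fact p.Prime] :
    addLegendre a p = if legendreSym p a = 1 then 0 else 1 := by
  rw [addLegendre, jacobiSym.legendreSym.to_jacobiSym]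

/-- `p^* = (-1)^((p-1)/2) p`, for an odd prime `p`. -/
def pStar (p : ℕ) : ℤ := (-1) ^ ((p - 1) / 2) * (p : ℤ)

/-- The Rédei matrix of a quadratic field of discriminant `D` whose distinct prime divisors are
`q 0, …, q t`, listed so that `q t = 2` if `D` is even.  It has one row for each prime except
the last one, and one column for each prime. -/
def redeiMatrix {t : ℕ} (D : ℤ) (q : Fin (t + 1) → ℕ) : Matrix (Fin t) (Fin (t + 1)) (ZMod 2) :=
  Matrix.of fun i j =>
    if j = i.castSucc then addLegendre (D / pStar (q i.castSucc)) (q i.castSucc)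
    else addLegendre (q j : ℤ) (q i.castSucc)

/-- The positive square-free divisors of `D`. -/
def sqfreeDivisors (D : ℤ) : Set ℕ := {m | 0 < m ∧ Squarefree m ∧ (m : ℤ) ∣ D}

/-- The group law `d₁ ⊙ d₂ = d₁ d₂ / (d₁, d₂)²` on positive square-free divisors. -/
def odot (d₁ d₂ : ℕ) : ℕ := d₁ * d₂ / (Nat.gcd d₁ d₂) ^ 2

/-- `m` is the norm of an element of `Kˣ`. -/
def IsFieldNorm (K : Type*) [Field K] [NumberField K] (m : ℕ) : Prop :=
  ∃ x : Kˣ, Algebra.norm ℚ (x : K) = (m : ℚ)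

/-- `(a, b, c)` is a positive primitive solution of `2^r z² = d x² + (n/d) y²`. -/
def IsPosPrimitiveSolution (n r d a b c : ℕ) : Prop :=
  0 < a ∧ 0 < b ∧ 0 < c ∧ Nat.gcd (Nat.gcd a b) c = 1 ∧
    2 ^ r * c ^ 2 = d * a ^ 2 + n / d * b ^ 2

/-- The class of the non-zero ideal `I` lies in `4𝒜`, where `𝒜` is the class group of `K` in
additive notation; Mathlib writes the class group multiplicatively. -/
def ClassMemFour {K : Type*} [Field K] [NumberField K] (I : Ideal (NumberField.RingOfIntegers K)) :
    Prop :=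
  ∃ hI : I ∈ nonZeroDivisors (Ideal (NumberField.RingOfIntegers K)),
    ∃ x : ClassGroup (NumberField.RingOfIntegers K), ClassGroup.mk0 ⟨I, hI⟩ = x ^ 4

/-- For `s = √-n` and a square-free divisor `m` of `2n`, the ideal `(m, n + √-n)`.  For
`n ≡ 1 mod 4` square-free, it is the ideal with square `(m)`, that is, the product of the ramified
primes over the prime divisors of `m`, see `ramIdeal_sq`.  For odd `m` it is also the ideal
`(m, (D + √D)/2)`, where `D = -4n`, see `ramIdeal_eq_of_odd`. -/
def ramIdeal {R : Type*} [CommRing R] (n : ℕ) (s : R) (m : ℕ) : Ideal R :=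
  Ideal.span {(m : R), (n : R) + s}

theorem ramIdeal_sq {R : Type*} [CommRing R] {n m : ℕ} {s : R} (hs : s ^ 2 = -(n : R))
    (hn : Squarefree n) (h4 : n % 4 = 1) (hm : m ∣ 2 * n) :
    ramIdeal n s m ^ 2 = Ideal.span {(m : R)} := by
  obtain ⟨e, he⟩ := hm
  have hα : ((n : R) + s) ^ 2 = 2 * n * ((n : R) + s) - n * (n + 1) := by linear_combination hs
  have heR : (2 * n : R) = m * e := by exact_mod_cast congrArg (Nat.cast : ℕ → R) he
  obtain ⟨j, hj⟩ : ∃ j, n + 1 = 2 * j := ⟨(n + 1) / 2, by omega⟩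
  have hjR : (n + 1 : R) = 2 * j := by exact_mod_cast congrArg (Nat.cast : ℕ → R) hj
  have hnj : (n * (n + 1) : R) = m * (e * j) := by linear_combination (n : R) * hjR + j * heR
  apply le_antisymm
  · rw [ramIdeal, sq, Ideal.span_mul_span', Ideal.span_le]
    rintro _ ⟨x, hx, y, hy, rfl⟩
    simp only [Set.mem_insert_iff, Set.mem_singleton_iff] at hx hy
    simp only [SetLike.mem_coe, Ideal.mem_span_singleton]
    rcases hx with rfl | rfl
    · exact dvd_mul_right _ _
    · rcases hy with rfl | rfl
      · exact dvd_mul_left _ _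
      · exact ⟨e * (n + s) - e * j, by linear_combination hα + (n + s) * heR - hnj⟩
  · have h2n : Squarefree (2 * n) :=
      (Nat.squarefree_mul ((Nat.coprime_two_left).2 (Nat.odd_iff.2 (by omega)))).2
        ⟨Nat.prime_two.squarefree, hn⟩
    have hc1 : Nat.Coprime m e := Nat.coprime_of_squarefree_mul (he ▸ h2n)
    have hc2 : Nat.Coprime m j := by
      refine Nat.Coprime.coprime_dvd_left ⟨e, he⟩ (Nat.Coprime.mul_left ?_ ?_)
      · exact (Nat.coprime_two_left).2 (Nat.odd_iff.2 (by omega))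
      · exact Nat.Coprime.coprime_dvd_right ⟨2, by omega⟩ (by simp : Nat.Coprime n (n + 1))
    have hc : IsCoprime (m : ℤ) ((e * j : ℕ) : ℤ) :=
      Nat.isCoprime_iff_coprime.2 (Nat.Coprime.mul_right hc1 hc2)
    obtain ⟨u, v, huv⟩ := hc
    have huvR : (u * m + v * (e * j) : R) = 1 := by
      exact_mod_cast congrArg (Int.cast : ℤ → R) huv
    rw [Ideal.span_singleton_le_iff_mem]
    have i1 : (m : R) ∈ ramIdeal n s m := Ideal.subset_span (by simp)
    have i2 : (n : R) + s ∈ ramIdeal n s m := Ideal.subset_span (by simp)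
    have e1 := Ideal.mul_mem_left _ (u : R) (Ideal.mul_mem_mul i1 i1)
    have e2 := Ideal.mul_mem_left _ (v * e : R) (Ideal.mul_mem_mul i1 i2)
    have e3 := Ideal.mul_mem_left _ (v : R) (Ideal.mul_mem_mul i2 i2)
    rw [sq]
    convert Ideal.sub_mem _ (Ideal.add_mem _ e1 e2) e3 using 1
    linear_combination (-(m : R)) * huvR + v * hα + v * (n + s) * heR - v * hnj

theorem ramIdeal_eq_of_odd {R : Type*} [CommRing R] {n m : ℕ} {s : R} (hm : m ∣ n) :
    ramIdeal n s m = Ideal.span {(m : R), -2 * (n : R) + s} := by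
  obtain ⟨e, rfl⟩ := hm
  rw [ramIdeal, ← Ideal.span_pair_add_mul_left (z := -3 * (e : R))]
  congr 3
  push_cast
  ring

end RedeiClass

/-! Genus theory. The characters `genusChar n (p i)`, evaluated at norms of ideals, vanish on
principal ideals, whose norms are values u² + nv². They therefore define g : 𝒜 → 𝔽₂^k
(`exists_genus_hom`), which is onto by Dirichlet's theorem and quadratic reciprocity
(`genus_hom_surjective`). The 2-torsion 𝒜[2] is spanned by the classes of the k + 1 ramified primes
(`exists_binaryProd_eq`), between which there is a nontrivial relation; hence |𝒜/2𝒜| = |𝒜[2]| ≤ 2^k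
and ker g = 2𝒜 (`exists_sq_of_mem_ker`). The entries of R are the values of g at the ramified primes
(`redeiMatrix_snoc_two_apply`), so Im R = g(𝒜[2]).

A primitive solution gives β = d_i a_i + b_i √-n of norm m c_i², where m = 2^{r_i} d_i, and (β) =
𝔡_m J_i² with J_i of norm c_i (`exists_ideal_of_solution`). Put γ = [J₁] + [J₂]. Then [𝔡_{2^r d}] =
-2γ and g(γ) = C₁ + C₂. Finally -2γ ∈ 4𝒜 iff γ ∈ 2𝒜 + 𝒜[2] iff g(γ) ∈ g(𝒜[2]) = Im R
(`exists_pow_four_iff`). -/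

open NumberField nonZeroDivisors
namespace RedeiClass

/-! ### Trace, norm and discriminant in a basis 1, √-n -/

section Basis
variable {R S : Type*} [CommRing R] [CommRing S] [Algebra R S]
  {s : S} {n : ℕ} (b : Module.Basis (Fin 2) R S)

/-- The base ring is left general because the formulas serve both K over ℚ and 𝓞 K over ℤ. -/
theorem leftMulMatrix_add_mul (hs : s ^ 2 = -(n : S)) (h0 : b 0 = 1) (h1 : b 1 = s) (x y : R) :
    Algebra.leftMulMatrix b (algebraMap R S x + algebraMap R S y * s) = !![x, -(n * y); y, x] := by
  have e0 : (algebraMap R S x + algebraMap R S y * s) * b 0 = x • b 0 + y • b 1 := by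
    rw [h0, h1, Algebra.smul_def, Algebra.smul_def]; ring
  have e1 : (algebraMap R S x + algebraMap R S y * s) * b 1 = (-(n * y)) • b 0 + x • b 1 := by
    rw [h0, h1, Algebra.smul_def, Algebra.smul_def]
    simp only [map_neg, map_mul, map_natCast]
    linear_combination (algebraMap R S y) * hs
  ext i j
  rw [Algebra.leftMulMatrix_eq_repr_mul]
  fin_cases j
  · simp only [Fin.zero_eta, e0]
    fin_cases i <;> simp
  · simp only [Fin.mk_one, e1]
    fin_cases i <;> simp

theorem trace_add_mul (hs : s ^ 2 = -(n : S)) (h0 : b 0 = 1) (h1 : b 1 = s) (x y : R) :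
    Algebra.trace R S (algebraMap R S x + algebraMap R S y * s) = 2 * x := by
  rw [Algebra.trace_eq_matrix_trace b, leftMulMatrix_add_mul b hs h0 h1, Matrix.trace_fin_two_of]
  ring

theorem norm_add_mul (hs : s ^ 2 = -(n : S)) (h0 : b 0 = 1) (h1 : b 1 = s) (x y : R) :
    Algebra.norm R (algebraMap R S x + algebraMap R S y * s) = x ^ 2 + n * y ^ 2 := by
  rw [Algebra.norm_eq_matrix_det b, leftMulMatrix_add_mul b hs h0 h1, Matrix.det_fin_two_of]
  ring

theorem discr_basis (hs : s ^ 2 = -(n : S)) (h0 : b 0 = 1) (h1 : b 1 = s) :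
    Algebra.discr R b = -4 * n := by
  have t := trace_add_mul b hs h0 h1
  have t0 : Algebra.trace R S 1 = 2 := by simpa using t 1 0
  have t1 : Algebra.trace R S s = 0 := by simpa using t 0 1
  have t2 : Algebra.trace R S (s ^ 2) = -2 * n := by
    rw [hs]
    simpa using t (-n) 0
  rw [Algebra.discr_def, Matrix.det_fin_two]
  simp only [Algebra.traceMatrix_apply, Algebra.traceForm_apply, h0, h1, one_mul, mul_one]
  rw [← sq s, t0, t1, t2]
  ring

end Basis

/-! ### The ring of integers is ℤ[√-n] -/

/-- The square of the denominator of y divides the square-free n. -/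
theorem int_of_sq_mul {n : ℕ} (hn : Squarefree n) {y : ℚ} {m : ℤ} (h : (n : ℚ) * y ^ 2 = m) :
    ∃ z : ℤ, y = z := by
  have hden : (y.den : ℤ) ^ 2 ∣ n := by
    have h2 : (n : ℤ) * y.num ^ 2 = m * y.den ^ 2 := by
      have hy : y * y.den = y.num := Rat.mul_den_eq_num y
      have : (n : ℚ) * (y.num : ℚ) ^ 2 = m * (y.den : ℚ) ^ 2 := by
        rw [← hy, ← h]; ring
      exact_mod_cast this
    have hc : IsCoprime ((y.den : ℤ) ^ 2) (y.num ^ 2) := by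
      apply IsCoprime.pow
      rw [Int.isCoprime_iff_gcd_eq_one, Int.gcd_comm]
      exact y.reduced
    exact hc.dvd_of_dvd_mul_right ⟨m, by rw [h2]; ring⟩
  have h1 : y.den * y.den ∣ n := by
    rw [← sq]; exact_mod_cast hden
  have h3 : y.den = 1 := Nat.isUnit_iff.1 (hn _ h1)
  exact ⟨y.num, (Rat.coe_int_num_of_den_eq_one h3).symm⟩

theorem int_coords_of_trace_norm {n : ℕ} (hn : Squarefree n) (h4 : n % 4 = 1) {x y : ℚ} {t m : ℤ}
    (ht : 2 * x = t) (hm : x ^ 2 + n * y ^ 2 = m) : ∃ u v : ℤ, x = u ∧ y = v := by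
  obtain ⟨z, hz⟩ : ∃ z : ℤ, 2 * y = z :=
    int_of_sq_mul hn (m := 4 * m - t ^ 2) (by push_cast; rw [← ht, ← hm]; ring)
  have h : t ^ 2 + n * z ^ 2 = 4 * m := by
    have : (t : ℚ) ^ 2 + n * z ^ 2 = 4 * m := by rw [← ht, ← hz, ← hm]; ring
    exact_mod_cast this
  obtain ⟨j, hj⟩ : ∃ j : ℤ, (n : ℤ) = 4 * j + 1 := ⟨n / 4, by omega⟩
  rw [hj] at h
  -- As n ≡ 1 mod 4, the equation reads t² + z² ≡ 0 mod 4, which forces both to be even.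
  have key : t % 2 = 0 ∧ z % 2 = 0 := by
    have h' : t ^ 2 + z ^ 2 = 4 * (m - j * z ^ 2) := by linear_combination h
    rcases Int.emod_two_eq_zero_or_one t with a | a <;>
      rcases Int.emod_two_eq_zero_or_one z with b | b
    · exact ⟨a, b⟩
    all_goals
      exfalso
      have ha := Int.emod_add_mul_ediv t 2
      have hb := Int.emod_add_mul_ediv z 2
      rw [a] at ha
      rw [b] at hb
      rw [← ha, ← hb] at h'
      ring_nf at h'
      omega
  refine ⟨t / 2, z / 2, ?_, ?_⟩
  · have : t = 2 * (t / 2) := by omega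
    have : (t : ℚ) = 2 * ((t / 2 : ℤ) : ℚ) := by exact_mod_cast this
    linarith
  · have : z = 2 * (z / 2) := by omega
    have : (z : ℚ) = 2 * ((z / 2 : ℤ) : ℚ) := by exact_mod_cast this
    linarith

section Field
variable {K : Type*} [Field K] [NumberField K] {n : ℕ} {s : 𝓞 K}

omit [NumberField K] in
theorem sq_coe (hs : s ^ 2 = -(n : 𝓞 K)) : (s : K) ^ 2 = -(n : K) := by
  have := congrArg (algebraMap (𝓞 K) K) hs
  simpa using this

theorem exists_rat_coords (hs : s ^ 2 = -(n : 𝓞 K))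
    (hK : IntermediateField.adjoin ℚ {(s : K)} = ⊤) (x : K) :
    ∃ a b : ℚ, x = algebraMap ℚ K a + algebraMap ℚ K b * s := by
  have hs' := sq_coe hs
  have hi : IsIntegral ℚ (s : K) := (Algebra.IsIntegral.isIntegral (R := ℚ) (s : K))
  have hx : x ∈ Algebra.adjoin ℚ {(s : K)} := by
    rw [← IntermediateField.adjoin_simple_toSubalgebra_of_isAlgebraic hi.isAlgebraic, hK]
    trivial
  induction hx using Algebra.adjoin_induction with
  | mem y hy => exact ⟨0, 1, by simp_all⟩
  | algebraMap r => exact ⟨r, 0, by simp⟩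
  | add y z _ _ hy hz =>
    obtain ⟨a, b, rfl⟩ := hy
    obtain ⟨c, d, rfl⟩ := hz
    exact ⟨a + c, b + d, by simp only [map_add]; ring⟩
  | mul y z _ _ hy hz =>
    obtain ⟨a, b, rfl⟩ := hy
    obtain ⟨c, d, rfl⟩ := hz
    refine ⟨a * c - n * (b * d), a * d + b * c, ?_⟩
    simp only [map_add, map_sub, map_mul, map_natCast]
    linear_combination (algebraMap ℚ K b * algebraMap ℚ K d) * hs'

theorem rat_coords_eq_zero (hn : 0 < n) (hs : s ^ 2 = -(n : 𝓞 K)) {a b : ℚ}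
    (h : algebraMap ℚ K a + algebraMap ℚ K b * s = 0) : a = 0 ∧ b = 0 := by
  have hs' := sq_coe hs
  have h2 : algebraMap ℚ K (a ^ 2 + n * b ^ 2) = 0 := by
    simp only [map_add, map_mul, map_pow, map_natCast]
    linear_combination (algebraMap ℚ K a - algebraMap ℚ K b * s) * h +
      (algebraMap ℚ K b) ^ 2 * hs'
  have h3 : a ^ 2 + n * b ^ 2 = 0 := (map_eq_zero_iff _ (algebraMap ℚ K).injective).1 h2
  have hn' : (0 : ℚ) < n := by exact_mod_cast hn
  have hb : b = 0 := by
    by_contra hb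
    have : 0 < b ^ 2 := by positivity
    nlinarith [sq_nonneg a, mul_pos hn' this]
  subst hb
  simpa using h3

theorem exists_rat_basis (hn : 0 < n) (hs : s ^ 2 = -(n : 𝓞 K))
    (hK : IntermediateField.adjoin ℚ {(s : K)} = ⊤) :
    ∃ b : Module.Basis (Fin 2) ℚ K, b 0 = 1 ∧ b 1 = s := by
  have hli : LinearIndependent ℚ ![(1 : K), s] := by
    rw [LinearIndependent.pair_iff]
    intro a b h
    exact rat_coords_eq_zero hn hs (by simpa [Algebra.smul_def] using h)
  have hsp : ⊤ ≤ Submodule.span ℚ (Set.range ![(1 : K), s]) := by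
    intro x _
    obtain ⟨a, b, rfl⟩ := exists_rat_coords hs hK x
    rw [Matrix.range_cons, Matrix.range_cons, Matrix.range_empty, Set.union_empty,
      Set.singleton_union, Submodule.mem_span_pair]
    exact ⟨a, b, by simp [Algebra.smul_def]⟩
  exact ⟨Module.Basis.mk hli hsp, by simp, by simp⟩

theorem exists_int_coords (hn : Squarefree n) (h4 : n % 4 = 1) (hs : s ^ 2 = -(n : 𝓞 K))
    (hK : IntermediateField.adjoin ℚ {(s : K)} = ⊤) (x : 𝓞 K) :
    ∃ u v : ℤ, x = u + v * s := by
  obtain ⟨B, h0, h1⟩ := exists_rat_basis (by omega) hs hK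
  obtain ⟨a, b, hab⟩ := exists_rat_coords hs hK (x : K)
  have hx : IsIntegral ℤ (x : K) := x.2
  obtain ⟨t, ht⟩ := IsIntegrallyClosed.isIntegral_iff.1 (Algebra.isIntegral_trace (L := ℚ) hx)
  obtain ⟨m, hm⟩ := IsIntegrallyClosed.isIntegral_iff.1 (Algebra.isIntegral_norm ℚ hx)
  rw [hab, trace_add_mul B (sq_coe hs) h0 h1] at ht
  rw [hab, norm_add_mul B (sq_coe hs) h0 h1] at hm
  obtain ⟨u, v, rfl, rfl⟩ := int_coords_of_trace_norm hn h4 (t := t) (m := m)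
    (by simpa using ht.symm) (by simpa using hm.symm)
  refine ⟨u, v, ?_⟩
  apply RingOfIntegers.ext
  rw [hab]
  simp

theorem int_coords_eq_zero (hn : 0 < n) (hs : s ^ 2 = -(n : 𝓞 K)) {u v : ℤ}
    (h : (u : 𝓞 K) + v * s = 0) : u = 0 ∧ v = 0 := by
  have := congrArg (algebraMap (𝓞 K) K) h
  have := rat_coords_eq_zero (a := u) (b := v) hn hs (by simpa using this)
  exact_mod_cast this

theorem exists_int_basis (hn : Squarefree n) (h4 : n % 4 = 1) (hs : s ^ 2 = -(n : 𝓞 K))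
    (hK : IntermediateField.adjoin ℚ {(s : K)} = ⊤) :
    ∃ b : Module.Basis (Fin 2) ℤ (𝓞 K), b 0 = 1 ∧ b 1 = s := by
  have hli : LinearIndependent ℤ ![(1 : 𝓞 K), s] := by
    rw [LinearIndependent.pair_iff]
    intro a b h
    exact int_coords_eq_zero (by omega) hs (by simpa [Algebra.smul_def] using h)
  have hsp : ⊤ ≤ Submodule.span ℤ (Set.range ![(1 : 𝓞 K), s]) := by
    intro x _
    obtain ⟨a, b, rfl⟩ := exists_int_coords hn h4 hs hK x
    rw [Matrix.range_cons, Matrix.range_cons, Matrix.range_empty, Set.union_empty,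
      Set.singleton_union, Submodule.mem_span_pair]
    exact ⟨a, b, by simp [Algebra.smul_def]⟩
  exact ⟨Module.Basis.mk hli hsp, by simp, by simp⟩

theorem discr_eq (hn : Squarefree n) (h4 : n % 4 = 1) (hs : s ^ 2 = -(n : 𝓞 K))
    (hK : IntermediateField.adjoin ℚ {(s : K)} = ⊤) : discr K = -4 * n := by
  obtain ⟨b, h0, h1⟩ := exists_int_basis hn h4 hs hK
  rw [← discr_eq_discr K b, discr_basis b hs h0 h1]

theorem absNorm_span_coords (hn : Squarefree n) (h4 : n % 4 = 1) (hs : s ^ 2 = -(n : 𝓞 K))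
    (hK : IntermediateField.adjoin ℚ {(s : K)} = ⊤) (u v : ℤ) :
    (Ideal.absNorm (Ideal.span {(u : 𝓞 K) + v * s}) : ℤ) = u ^ 2 + n * v ^ 2 := by
  obtain ⟨b, h0, h1⟩ := exists_int_basis hn h4 hs hK
  have h := norm_add_mul b hs h0 h1 u v
  simp only [eq_intCast] at h
  rw [Ideal.absNorm_span_singleton, h, Int.natCast_natAbs, abs_of_nonneg (by positivity)]

theorem absNorm_span_natCast_eq_sq (hn : Squarefree n) (h4 : n % 4 = 1) (hs : s ^ 2 = -(n : 𝓞 K))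
    (hK : IntermediateField.adjoin ℚ {(s : K)} = ⊤) (m : ℕ) :
    Ideal.absNorm (Ideal.span {(m : 𝓞 K)}) = m ^ 2 := by
  have := absNorm_span_coords hn h4 hs hK m 0
  simp only [Int.cast_natCast, Int.cast_zero, zero_mul, add_zero] at this
  zify
  rw [this]
  ring

end Field

/-! ### Additive Legendre symbols and genus characters -/

theorem addLegendre_mul {p : ℕ} {a b : ℤ} (ha : a.gcd p = 1) (hb : b.gcd p = 1) :
    addLegendre (a * b) p = addLegendre a p + addLegendre b p := by
  rw [addLegendre, addLegendre, addLegendre, jacobiSym.mul_left]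
  rcases jacobiSym.eq_one_or_neg_one ha with h | h <;>
    rcases jacobiSym.eq_one_or_neg_one hb with h' | h' <;> rw [h, h'] <;> decide

theorem addLegendre_sq {p : ℕ} {a : ℤ} (ha : a.gcd p = 1) : addLegendre (a ^ 2) p = 0 := by
  rw [addLegendre, jacobiSym.sq_one' ha, if_pos rfl]

theorem addLegendre_congr {p : ℕ} {a b : ℤ} (h : a ≡ b [ZMOD p]) :
    addLegendre a p = addLegendre b p := by
  rw [addLegendre, addLegendre, jacobiSym.mod_left' h]

theorem addLegendre_one (p : ℕ) : addLegendre 1 p = 0 := by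
  rw [addLegendre, jacobiSym.one_left, if_pos rfl]

/-- The character of conductor `p` that sends a positive integer `N` to the Hilbert symbol
`(N, -n)_p`, written additively, for a prime `p ≡ 1 mod 4` with `p ∥ n`. -/
noncomputable def genusChar (n p N : ℕ) : ZMod 2 :=
  addLegendre ((N / p ^ N.factorization p : ℕ) : ℤ) p +
    N.factorization p * addLegendre ((n / p : ℕ) : ℤ) p

section GenusChar
variable {n p : ℕ}

theorem gcd_natCast_eq_one (hp : p.Prime) {N : ℕ} (h : ¬p ∣ N) : (N : ℤ).gcd p = 1 :=
  ((Nat.Prime.coprime_iff_not_dvd hp).2 h).symm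

theorem gcd_eq_one_of_not_dvd (hp : p.Prime) {x : ℤ} (h : ¬(p : ℤ) ∣ x) : x.gcd p = 1 := by
  rw [Int.gcd, Int.natAbs_natCast]
  exact ((Nat.Prime.coprime_iff_not_dvd hp).2 (by rwa [← Int.natCast_dvd])).symm

theorem genusChar_of_not_dvd {N : ℕ} (h : ¬p ∣ N) : genusChar n p N = addLegendre N p := by
  simp [genusChar, Nat.factorization_eq_zero_of_not_dvd h]

theorem genusChar_self (hp : p.Prime) : genusChar n p p = addLegendre ((n / p : ℕ) : ℤ) p := by
  simp [genusChar, hp.factorization_self, hp.pos, addLegendre_one]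

theorem genusChar_mul (hp : p.Prime) {M N : ℕ} (hM : M ≠ 0) (hN : N ≠ 0) :
    genusChar n p (M * N) = genusChar n p M + genusChar n p N := by
  have h := Nat.ordCompl_mul M N p
  rw [genusChar, h, Nat.cast_mul, addLegendre_mul
    (gcd_natCast_eq_one hp (Nat.not_dvd_ordCompl hp hM))
    (gcd_natCast_eq_one hp (Nat.not_dvd_ordCompl hp hN)), Nat.factorization_mul hM hN,
    genusChar, genusChar]
  simp only [Finsupp.add_apply, Nat.cast_add]
  ring

theorem genusChar_sq (hp : p.Prime) {M : ℕ} (hM : M ≠ 0) : genusChar n p (M ^ 2) = 0 := by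
  rw [sq, genusChar_mul hp hM hM, CharTwo.add_self_eq_zero]

/-- Descent on N, with n = pe. If p divides x and y, a factor p² drops out. If p divides only x,
then N = pM with M ≡ ey² mod p, and the contributions [e/p] of p and of M cancel. If p does not
divide x, then N ≡ x² mod p. -/
theorem genusChar_norm (hp : p.Prime) (hn : Squarefree n) (hpn : p ∣ n) (N : ℕ) :
    ∀ x y : ℤ, (N : ℤ) = x ^ 2 + n * y ^ 2 → N ≠ 0 → genusChar n p N = 0 := by
  obtain ⟨e, rfl⟩ := hpn
  have hpe : ¬p ∣ e := fun h =>
    hp.one_lt.ne' (Nat.isUnit_iff.1 (hn p (Nat.mul_dvd_mul_left p h)))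
  induction N using Nat.strong_induction_on with
  | _ N ih =>
  intro x y hN h0
  have hp0 : (p : ℤ) ≠ 0 := by exact_mod_cast hp.ne_zero
  have hpp : Prime (p : ℤ) := Nat.prime_iff_prime_int.1 hp
  by_cases hx : (p : ℤ) ∣ x
  · obtain ⟨x, rfl⟩ := hx
    by_cases hy : (p : ℤ) ∣ y
    · obtain ⟨y, rfl⟩ := hy
      obtain ⟨M, hM⟩ : ∃ M : ℕ, (M : ℤ) = x ^ 2 + ((p * e : ℕ) : ℤ) * y ^ 2 :=
        ⟨(x ^ 2 + ((p * e : ℕ) : ℤ) * y ^ 2).toNat, Int.toNat_of_nonneg (by positivity)⟩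
      have hNM : N = p ^ 2 * M := by
        zify
        rw [hN, hM]
        ring
      have hM0 : M ≠ 0 := by
        rintro rfl
        simp_all
      rw [hNM, genusChar_mul hp (pow_ne_zero 2 hp.ne_zero) hM0, genusChar_sq hp hp.ne_zero,
        ih M _ x y hM hM0, add_zero]
      rw [hNM]
      exact lt_mul_of_one_lt_left (Nat.pos_of_ne_zero hM0) (Nat.one_lt_pow two_ne_zero hp.one_lt)
    · obtain ⟨M, hM⟩ : ∃ M : ℕ, (M : ℤ) = p * x ^ 2 + e * y ^ 2 :=
        ⟨(p * x ^ 2 + e * y ^ 2 : ℤ).toNat, Int.toNat_of_nonneg (by positivity)⟩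
      have hNM : N = p * M := by
        zify
        rw [hN, hM]
        push_cast
        ring
      have hM0 : M ≠ 0 := by
        rintro rfl
        simp_all
      have hpM : ¬p ∣ M := by
        intro h
        have h1 : (p : ℤ) ∣ e * y ^ 2 := by
          rw [← Int.natCast_dvd_natCast, hM] at h
          exact (Int.dvd_add_right (dvd_mul_right _ _)).1 h
        rcases hpp.dvd_or_dvd h1 with h2 | h2
        · exact hpe (Int.natCast_dvd_natCast.1 h2)
        · exact hy (hpp.dvd_of_dvd_pow h2)
      have hy1 := gcd_eq_one_of_not_dvd hp hy
      have hc : (M : ℤ) ≡ e * y ^ 2 [ZMOD p] := by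
        rw [hM]
        exact (Int.modEq_iff_dvd.2 ⟨-x ^ 2, by ring⟩)
      have hy2 : (y ^ 2).gcd p = 1 := by
        rw [← Int.isCoprime_iff_gcd_eq_one] at hy1 ⊢
        exact hy1.pow_left
      rw [hNM, genusChar_mul hp hp.ne_zero hM0, genusChar_self hp, genusChar_of_not_dvd hpM,
        addLegendre_congr hc, addLegendre_mul (gcd_natCast_eq_one hp hpe) hy2, addLegendre_sq hy1,
        add_zero, Nat.mul_div_cancel_left _ hp.pos, CharTwo.add_self_eq_zero]
  · have hc : (N : ℤ) ≡ x ^ 2 [ZMOD p] := by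
      rw [hN]
      exact (Int.modEq_iff_dvd.2 ⟨-(e * y ^ 2), by push_cast; ring⟩)
    have hpN : ¬p ∣ N := by
      intro h
      have := (Int.ModEq.dvd_iff hc).1 (Int.natCast_dvd_natCast.2 h)
      exact hx (hpp.dvd_of_dvd_pow this)
    rw [genusChar_of_not_dvd hpN, addLegendre_congr hc,
      addLegendre_sq (gcd_eq_one_of_not_dvd hp hx)]

end GenusChar

/-! ### Split primes with prescribed symbols -/

theorem jacobiSym_prod_right {ι : Type*} (S : Finset ι) (a : ℤ) (p : ι → ℕ)
    (hp : ∀ i ∈ S, p i ≠ 0) : jacobiSym a (∏ i ∈ S, p i) = ∏ i ∈ S, jacobiSym a (p i) := by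
  classical
  induction S using Finset.induction_on with
  | empty => simp
  | insert i S hi ih =>
    rw [Finset.prod_insert hi, Finset.prod_insert hi,
      jacobiSym.mul_right' a (hp i (by simp))
        (Finset.prod_ne_zero_iff.2 fun j hj => hp j (by simp [hj])),
      ih fun j hj => hp j (by simp [hj])]

theorem exists_jacobiSym_eq {p : ℕ} (hp : p.Prime) (h4 : p % 4 = 1) (ε : ZMod 2) :
    ∃ a : ℕ, a.Coprime p ∧ jacobiSym a p = if ε = 0 then 1 else -1 := by
  by_cases h : ε = 0
  · exact ⟨1, by simp, by simp [h]⟩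
  · have : Fact p.Prime := ⟨hp⟩
    obtain ⟨x, hx⟩ := FiniteField.exists_nonsquare (F := ZMod p) (by
      rw [ZMod.ringChar_zmod_n]; rintro rfl; omega)
    have hj : jacobiSym (x.val : ℕ) p = -1 := by
      rw [← jacobiSym.legendreSym.to_jacobiSym, legendreSym.eq_neg_one_iff, Int.cast_natCast,
        ZMod.natCast_zmod_val]
      exact hx
    refine ⟨x.val, ?_, by rw [hj, if_neg h]⟩
    have h0 : jacobiSym (x.val : ℕ) p ≠ 0 := by rw [hj]; decide
    by_contra hc
    exact h0 (jacobiSym.eq_zero_iff.2 ⟨hp.ne_zero, hc⟩)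

theorem coprime_of_squarefree_prod {k : ℕ} {p : Fin k → ℕ} (hsq : Squarefree (∏ i, p i))
    {i j : Fin k} (hij : i ≠ j) : (p i).Coprime (p j) := by
  apply Nat.coprime_of_squarefree_mul
  refine hsq.squarefree_of_dvd ?_
  rw [← Finset.prod_pair hij]
  exact Finset.prod_dvd_prod_of_subset _ _ _ (Finset.subset_univ _)

/-- Dirichlet's theorem gives q in prescribed classes modulo 4 and each p i. The class modulo 4 is
the remaining freedom, used to make -n a square modulo q. -/
theorem exists_prime_of_symbols {k : ℕ} {p : Fin k → ℕ} (hp : ∀ i, (p i).Prime)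
    (hp4 : ∀ i, p i % 4 = 1) (hsq : Squarefree (∏ i, p i)) (h4 : (∏ i, p i) % 4 = 1)
    (ε : Fin k → ZMod 2) :
    ∃ q : ℕ, q.Prime ∧ q.Coprime (2 * ∏ i, p i) ∧ (∀ i, addLegendre q (p i) = ε i) ∧
      ∃ t : ℤ, (q : ℤ) ∣ t ^ 2 + (∏ i, p i : ℕ) := by
  set n := ∏ i, p i with hn
  choose a ha hja using fun i => exists_jacobiSym_eq (hp i) (hp4 i) (ε i)
  set δ : ℤ := ∏ i, jacobiSym (a i) (p i) with hδ
  have hδ1 : δ = 1 ∨ δ = -1 := by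
    apply Int.isUnit_iff.1
    rw [hδ]
    refine (Finset.prod_induction _ IsUnit (fun _ _ => IsUnit.mul) isUnit_one fun i _ => ?_)
    rw [hja]
    split_ifs <;> simp
  -- The residue modulo 4 is chosen so that χ₄(q) = δ.
  let A : Fin (k + 1) → ℕ := Fin.cons (if δ = 1 then 1 else 3) a
  let M : Fin (k + 1) → ℕ := Fin.cons 4 p
  have hodd : ∀ i, (p i).Coprime 4 := fun i => by
    have h2 : (p i).Coprime 2 := (Nat.coprime_two_right).2 (Nat.odd_iff.2 (by have := hp4 i; omega))
    exact Nat.Coprime.mul_right h2 h2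
  have hM0 : ∀ i ∈ Finset.univ, M i ≠ 0 := fun i _ => by
    refine Fin.cases ?_ (fun j => ?_) i
    · simp [M]
    · simpa [M] using (hp j).ne_zero
  have hMc : Set.Pairwise (Finset.univ : Finset (Fin (k + 1))) (Function.onFun Nat.Coprime M) := by
    intro i _ j _ hij
    rw [Function.onFun]
    revert hij
    refine Fin.cases ?_ (fun i => ?_) i <;> refine Fin.cases ?_ (fun j => ?_) j <;> intro hij
    · exact absurd rfl hij
    · simpa [M] using (hodd j).symm
    · simpa [M] using (hodd i)
    · simpa [M] using coprime_of_squarefree_prod hsq (fun h => hij (by rw [h]))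
  obtain ⟨x, hx⟩ := Nat.chineseRemainderOfFinset A M Finset.univ hM0 hMc
  have hx0 : x ≡ (if δ = 1 then 1 else 3) [MOD 4] := by simpa [A, M] using hx 0 (Finset.mem_univ _)
  have hxi : ∀ i, x ≡ a i [MOD p i] := fun i => by
    simpa [A, M] using hx i.succ (Finset.mem_univ _)
  have hxc : x.Coprime (4 * n) := by
    refine Nat.Coprime.mul_right ?_ ?_
    · rw [Nat.Coprime, hx0.gcd_eq]
      split_ifs <;> decide
    · rw [hn]
      refine Nat.Coprime.prod_right fun i _ => ?_
      rw [Nat.Coprime, (hxi i).gcd_eq]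
      exact ha i
  have hn0 : 4 * n ≠ 0 := by omega
  have : NeZero (4 * n) := ⟨hn0⟩
  obtain ⟨q, -, hq, hqx⟩ := Nat.forall_exists_prime_gt_and_eq_mod
    ((ZMod.isUnit_iff_coprime x (4 * n)).2 hxc) 0
  rw [ZMod.natCast_eq_natCast_iff] at hqx
  have hq4 : q ≡ (if δ = 1 then 1 else 3) [MOD 4] := (hqx.of_dvd (dvd_mul_right _ _)).trans hx0
  have hqi : ∀ i, q ≡ a i [MOD p i] := fun i =>
    (hqx.of_dvd (dvd_mul_of_dvd_right (Finset.dvd_prod_of_mem _ (Finset.mem_univ i)) _)).trans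
      (hxi i)
  have hji : ∀ i, jacobiSym q (p i) = jacobiSym (a i) (p i) := fun i =>
    jacobiSym.mod_left' (by exact_mod_cast hqi i)
  have hqodd : Odd q := by
    rw [Nat.odd_iff]
    unfold Nat.ModEq at hq4
    split_ifs at hq4 <;> omega
  have : Fact q.Prime := ⟨hq⟩
  -- As n ≡ 1 mod 4, reciprocity gives (-n/q) = χ₄(q) ∏ (q/p_i) = χ₄(q) δ = δ² = 1.
  have hjq : jacobiSym (-n) q = 1 := by
    rw [jacobiSym.neg _ hqodd, jacobiSym.quadratic_reciprocity_one_mod_four h4 hqodd, hn,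
      jacobiSym_prod_right _ _ _ fun i _ => (hp i).ne_zero, Finset.prod_congr rfl fun i _ => hji i,
      ← hδ]
    rcases hδ1 with h | h
    · rw [h, if_pos rfl] at hq4
      rw [h, ZMod.χ₄_nat_one_mod_four hq4, mul_one]
    · rw [h, if_neg (by decide)] at hq4
      rw [h, ZMod.χ₄_nat_three_mod_four hq4]
      rfl
  refine ⟨q, hq, ?_, ?_, ?_⟩
  · have : q.Coprime (4 * n) := by rw [Nat.Coprime, hqx.gcd_eq]; exact hxc
    exact this.coprime_dvd_right ⟨2, by ring⟩
  · intro i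
    rw [addLegendre, hji, hja]
    generalize ε i = z
    revert z
    decide
  · obtain ⟨y, hy⟩ := ZMod.isSquare_of_jacobiSym_eq_one hjq
    refine ⟨y.val, ?_⟩
    rw [← ZMod.intCast_zmod_eq_zero_iff_dvd]
    push_cast
    rw [ZMod.natCast_zmod_val]
    push_cast at hy
    linear_combination -hy


/-! ### Two-torsion and squares in abelian groups -/

section Group
variable {A : Type*} [CommGroup A]

/-- The product of the `c j` with `v j = 1`. -/
def binaryProd {ι : Type*} [Fintype ι] (c : ι → A) (v : ι → ZMod 2) : A := ∏ j, c j ^ (v j).val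

theorem binaryProd_add {ι : Type*} [Fintype ι] {c : ι → A} (hc : ∀ j, c j ^ 2 = 1)
    (v w : ι → ZMod 2) : binaryProd c (v + w) = binaryProd c v * binaryProd c w := by
  rw [binaryProd, binaryProd, binaryProd, ← Finset.prod_mul_distrib]
  refine Finset.prod_congr rfl fun j _ => ?_
  rw [Pi.add_apply, ZMod.val_add, ← pow_add, ← pow_mod_orderOf,
    ← pow_mod_orderOf _ ((v j).val + _),
    Nat.mod_mod_of_dvd _ (orderOf_dvd_of_pow_eq_one (hc j))]

theorem binaryProd_sq {ι : Type*} [Fintype ι] {c : ι → A} (hc : ∀ j, c j ^ 2 = 1)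
    (v : ι → ZMod 2) : binaryProd c v ^ 2 = 1 := by
  rw [binaryProd, ← Finset.prod_pow]
  exact Finset.prod_eq_one fun j _ => by rw [← pow_mul, mul_comm, pow_mul, hc, one_pow]

theorem binaryProd_indicator {ι : Type*} [Fintype ι] [DecidableEq ι] (c : ι → A) (S : Finset ι) :
    binaryProd c (fun j => if j ∈ S then 1 else 0) = ∏ j ∈ S, c j := by
  rw [binaryProd, ← Finset.prod_filter_mul_prod_filter_not Finset.univ (· ∈ S),
    Finset.filter_mem_eq_inter, Finset.univ_inter]
  rw [Finset.prod_congr rfl fun j hj => by rw [if_pos hj],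
    Finset.prod_eq_one (s := Finset.univ.filter (· ∉ S)) fun j hj => by
      rw [if_neg (Finset.mem_filter.1 hj).2, ZMod.val_zero, pow_zero]]
  simp [ZMod.val_one]

/-- The relation `e` involves c 0, so c 0 is redundant and the other k elements already generate the
2-torsion. -/
theorem card_two_torsion_le {k : ℕ} {c : Fin (k + 1) → A} (hc : ∀ j, c j ^ 2 = 1)
    {e : Fin (k + 1) → ZMod 2} (he0 : e 0 = 1) (he : binaryProd c e = 1)
    (hsurj : ∀ x : A, x ^ 2 = 1 → ∃ v, binaryProd c v = x) :
    Nat.card (powMonoidHom 2 : A →* A).ker ≤ 2 ^ k := by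
  have hcard : Nat.card (Fin k → ZMod 2) = 2 ^ k := by simp
  rw [← hcard]
  let f : (Fin k → ZMod 2) → (powMonoidHom 2 : A →* A).ker := fun w =>
    ⟨binaryProd c (Fin.cons 0 w), by
      rw [MonoidHom.mem_ker, powMonoidHom_apply, binaryProd_sq hc]⟩
  refine Nat.card_le_card_of_surjective f ?_
  rintro ⟨x, hx⟩
  obtain ⟨v, rfl⟩ := hsurj x hx
  have key : ∃ v' : Fin (k + 1) → ZMod 2, v' 0 = 0 ∧ binaryProd c v' = binaryProd c v := by
    have h01 : ∀ z : ZMod 2, z = 0 ∨ z = 1 := by decide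
    rcases h01 (v 0) with h | h
    · exact ⟨v, h, rfl⟩
    · refine ⟨v + e, ?_, by rw [binaryProd_add hc, he, mul_one]⟩
      rw [Pi.add_apply, h, he0]
      rfl
  obtain ⟨v', h0, hv'⟩ := key
  refine ⟨Fin.tail v', Subtype.ext ?_⟩
  change binaryProd c (Fin.cons 0 (Fin.tail v')) = _
  rw [← h0, Fin.cons_self_tail, hv']

/-- The squares lie in ker g, which has index 2^k. Their own index is the order of the 2-torsion, at
most 2^k, so the two subgroups coincide. -/
theorem exists_sq_of_mem_ker [Finite A] {k : ℕ} {g : A →* Multiplicative (Fin k → ZMod 2)}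
    (hg : Function.Surjective g) (hA : Nat.card (powMonoidHom 2 : A →* A).ker ≤ 2 ^ k)
    {x : A} (hx : g x = 1) : ∃ y, x = y ^ 2 := by
  have hsub : (powMonoidHom 2 : A →* A).range ≤ g.ker := by
    rintro _ ⟨y, rfl⟩
    rw [MonoidHom.mem_ker, powMonoidHom_apply, map_pow]
    apply Multiplicative.toAdd.injective
    rw [toAdd_pow, toAdd_one]
    ext i
    exact CharTwo.two_nsmul _
  have h1 : Nat.card g.ker * 2 ^ k = Nat.card A := by
    rw [← Subgroup.card_mul_index g.ker, Subgroup.index_ker, MonoidHom.range_eq_top.2 hg,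
      Subgroup.card_top]
    simp
  have h2 : Nat.card (powMonoidHom 2 : A →* A).ker * Nat.card (powMonoidHom 2 : A →* A).range =
      Nat.card A := by
    rw [← Subgroup.index_ker, Subgroup.card_mul_index]
  have h3 : Nat.card g.ker ≤ Nat.card (powMonoidHom 2 : A →* A).range := by
    have : 2 ^ k * Nat.card g.ker ≤ 2 ^ k * Nat.card (powMonoidHom 2 : A →* A).range := by
      rw [mul_comm, h1, ← h2]
      exact Nat.mul_le_mul_right _ hA
    exact Nat.le_of_mul_le_mul_left this (by positivity)
  have h4 := Subgroup.eq_of_le_of_card_ge hsub h3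
  have h5 : x ∈ g.ker := hx
  rw [← h4] at h5
  obtain ⟨y, rfl⟩ := h5
  exact ⟨y, rfl⟩

end Group

/-! ### Ideals determined by their squares -/

section Dedekind
variable {R : Type*} [CommRing R] [IsDedekindDomain R]

theorem ideal_dvd_of_sq_dvd_sq {I J : Ideal R} (hJ : J ≠ 0) (h : I ^ 2 ∣ J ^ 2) : I ∣ J := by
  classical
  have hI : I ≠ 0 := by
    rintro rfl
    rw [zero_pow two_ne_zero, zero_dvd_iff] at h
    exact hJ (pow_eq_zero_iff two_ne_zero |>.1 h)
  rw [UniqueFactorizationMonoid.dvd_iff_normalizedFactors_le_normalizedFactors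
    (pow_ne_zero 2 hI) (pow_ne_zero 2 hJ), UniqueFactorizationMonoid.normalizedFactors_pow,
    UniqueFactorizationMonoid.normalizedFactors_pow] at h
  rw [UniqueFactorizationMonoid.dvd_iff_normalizedFactors_le_normalizedFactors hI hJ,
    Multiset.le_iff_count]
  intro a
  have := Multiset.le_iff_count.1 h a
  rw [Multiset.count_nsmul, Multiset.count_nsmul] at this
  omega

theorem ideal_eq_of_sq_eq_sq {I J : Ideal R} (hJ : J ≠ 0) (h : I ^ 2 = J ^ 2) : I = J := by
  have hI : I ≠ 0 := by
    rintro rfl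
    rw [zero_pow two_ne_zero, eq_comm] at h
    exact hJ (pow_eq_zero_iff two_ne_zero |>.1 h)
  exact dvd_antisymm (ideal_dvd_of_sq_dvd_sq hJ h.dvd) (ideal_dvd_of_sq_dvd_sq hI h.symm.dvd)

theorem mk0_eq_one_of_span {I : (Ideal R)⁰} {x : R} (h : (I : Ideal R) = Ideal.span {x}) :
    ClassGroup.mk0 I = 1 := by
  rw [ClassGroup.mk0_eq_one_iff, h]
  exact ⟨⟨x, rfl⟩⟩

theorem mk0_mul_eq_one_of_span {I J : (Ideal R)⁰} {x : R}
    (h : (I : Ideal R) * J = Ideal.span {x}) : ClassGroup.mk0 I * ClassGroup.mk0 J = 1 := by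
  rw [← map_mul]
  exact mk0_eq_one_of_span (x := x) (by simpa using h)

/-- I and the product of the P j over S have the same square, hence are equal. -/
theorem mk0_eq_binaryProd {ι : Type*} [Fintype ι] [DecidableEq ι] {q : ι → R} {P : ι → (Ideal R)⁰}
    (hP : ∀ j, (P j : Ideal R) ^ 2 = Ideal.span {q j}) {S : Finset ι} {I : (Ideal R)⁰}
    (hI : (I : Ideal R) ^ 2 = Ideal.span {∏ j ∈ S, q j}) :
    ClassGroup.mk0 I = binaryProd (fun j => ClassGroup.mk0 (P j)) fun j => if j ∈ S then 1 else 0 := by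
  rw [binaryProd_indicator, ← map_prod]
  congr 1
  apply Subtype.ext
  refine ideal_eq_of_sq_eq_sq (nonZeroDivisors.ne_zero (∏ j ∈ S, P j).2) ?_
  rw [hI, SubmonoidClass.coe_finsetProd, ← Finset.prod_pow, Finset.prod_congr rfl fun j _ => hP j,
    Ideal.prod_span_singleton]

end Dedekind

/-! ### The genus homomorphism, ambiguous classes and split primes -/

section Field
variable {K : Type*} [Field K] [NumberField K] {n : ℕ} {s : 𝓞 K}

theorem int_coords_ext (hn : 0 < n) (hs : s ^ 2 = -(n : 𝓞 K)) {u v u' v' : ℤ}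
    (h : (u : 𝓞 K) + v * s = u' + v' * s) : u = u' ∧ v = v' := by
  have := int_coords_eq_zero (u := u - u') (v := v - v') hn hs
    (by push_cast; linear_combination h)
  omega

/-- Equivalent ideals satisfy (x)I = (y)J, and the characters vanish on the norms of (x) and (y). So
the value depends only on the class and may be computed on any representative. -/
theorem exists_genus_hom {k : ℕ} {p : Fin k → ℕ} (hp : ∀ i, (p i).Prime) (hpn : ∀ i, p i ∣ n)
    (hn : Squarefree n) (h4 : n % 4 = 1) (hs : s ^ 2 = -(n : 𝓞 K))
    (hK : IntermediateField.adjoin ℚ {(s : K)} = ⊤) :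
    ∃ g : ClassGroup (𝓞 K) →* Multiplicative (Fin k → ZMod 2), ∀ (I : (Ideal (𝓞 K))⁰) (i : Fin k),
      (g (ClassGroup.mk0 I)).toAdd i = genusChar n (p i) (Ideal.absNorm (I : Ideal (𝓞 K))) := by
  have hN0 : ∀ I : (Ideal (𝓞 K))⁰, Ideal.absNorm (I : Ideal (𝓞 K)) ≠ 0 :=
    Ideal.absNorm_ne_zero_of_nonZeroDivisors
  have hprin : ∀ (x : 𝓞 K) (i : Fin k), x ≠ 0 →
      Ideal.absNorm (Ideal.span {x}) ≠ 0 ∧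
        genusChar n (p i) (Ideal.absNorm (Ideal.span {x})) = 0 := by
    intro x i hx
    have h0 : Ideal.absNorm (Ideal.span {x}) ≠ 0 := by
      rw [Ne, Ideal.absNorm_eq_zero_iff, Ideal.span_singleton_eq_bot]
      exact hx
    refine ⟨h0, ?_⟩
    obtain ⟨u, v, rfl⟩ := exists_int_coords hn h4 hs hK x
    exact genusChar_norm (hp i) hn (hpn i) _ u v (absNorm_span_coords hn h4 hs hK u v) h0
  have hwd : ∀ I J : (Ideal (𝓞 K))⁰, ClassGroup.mk0 I = ClassGroup.mk0 J → ∀ i,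
      genusChar n (p i) (Ideal.absNorm (I : Ideal (𝓞 K))) =
        genusChar n (p i) (Ideal.absNorm (J : Ideal (𝓞 K))) := by
    intro I J h i
    obtain ⟨x, y, hx, hy, hxy⟩ := ClassGroup.mk0_eq_mk0_iff.1 h
    have h1 := congrArg (fun L => genusChar n (p i) (Ideal.absNorm L)) hxy
    simp only [map_mul] at h1
    rwa [genusChar_mul (hp i) (hprin x i hx).1 (hN0 I), genusChar_mul (hp i) (hprin y i hy).1 (hN0 J),
      (hprin x i hx).2, (hprin y i hy).2, zero_add, zero_add] at h1
  choose rep hrep using ClassGroup.mk0_surjective (R := 𝓞 K)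
  let g : ClassGroup (𝓞 K) →* Multiplicative (Fin k → ZMod 2) := MonoidHom.mk'
    (fun c => Multiplicative.ofAdd fun i =>
      genusChar n (p i) (Ideal.absNorm (rep c : Ideal (𝓞 K)))) (by
      intro a b
      apply Multiplicative.toAdd.injective
      ext i
      simp only [toAdd_mul, toAdd_ofAdd, Pi.add_apply]
      rw [← genusChar_mul (hp i) (hN0 _) (hN0 _), ← map_mul, ← Submonoid.coe_mul]
      exact hwd _ _ (by rw [hrep, map_mul, hrep, hrep]) i)
  exact ⟨g, fun I i => hwd _ _ (hrep _) i⟩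

theorem mem_span_natCast (hn : Squarefree n) (h4 : n % 4 = 1) (hs : s ^ 2 = -(n : 𝓞 K))
    (hK : IntermediateField.adjoin ℚ {(s : K)} = ⊤) {m : ℕ} {u v : ℤ} :
    (u : 𝓞 K) + v * s ∈ Ideal.span {(m : 𝓞 K)} ↔ (m : ℤ) ∣ u ∧ (m : ℤ) ∣ v := by
  rw [Ideal.mem_span_singleton]
  constructor
  · rintro ⟨x, hx⟩
    obtain ⟨a, b, rfl⟩ := exists_int_coords hn h4 hs hK x
    obtain ⟨rfl, rfl⟩ := int_coords_ext (u' := m * a) (v' := m * b) (by omega) hs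
      (by rw [hx]; push_cast; ring)
    exact ⟨dvd_mul_right _ _, dvd_mul_right _ _⟩
  · rintro ⟨⟨a, rfl⟩, ⟨b, rfl⟩⟩
    exact ⟨a + b * s, by push_cast; ring⟩

/-- An unramified l generates a radical ideal; this is read off from (u + vs)² = (u² - nv²) + 2uv s.
-/
theorem mem_span_of_sq_mem (hn : Squarefree n) (h4 : n % 4 = 1) (hs : s ^ 2 = -(n : 𝓞 K))
    (hK : IntermediateField.adjoin ℚ {(s : K)} = ⊤) {l : ℕ} (hl : l.Prime) (hln : ¬l ∣ 2 * n)
    {x : 𝓞 K} (hx : x ^ 2 ∈ Ideal.span {(l : 𝓞 K)}) : x ∈ Ideal.span {(l : 𝓞 K)} := by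
  obtain ⟨u, v, rfl⟩ := exists_int_coords hn h4 hs hK x
  have hx2 : ((u : 𝓞 K) + v * s) ^ 2 =
      ((u ^ 2 - n * v ^ 2 : ℤ) : 𝓞 K) + ((2 * u * v : ℤ) : 𝓞 K) * s := by
    push_cast
    linear_combination (v : 𝓞 K) ^ 2 * hs
  rw [hx2, mem_span_natCast hn h4 hs hK] at hx
  rw [mem_span_natCast hn h4 hs hK]
  have hlp : Prime (l : ℤ) := Nat.prime_iff_prime_int.1 hl
  have hl2 : ¬(l : ℤ) ∣ 2 := fun h => hln (dvd_mul_of_dvd_left (by exact_mod_cast h) _)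
  have hln' : ¬(l : ℤ) ∣ n := fun h => hln (dvd_mul_of_dvd_right (by exact_mod_cast h) _)
  obtain ⟨h1, h2⟩ := hx
  have huv : (l : ℤ) ∣ u → (l : ℤ) ∣ v := by
    intro hu
    have h3 : (l : ℤ) ∣ n * v ^ 2 := by
      have := dvd_sub (dvd_pow hu two_ne_zero) h1
      simpa using this
    exact hlp.dvd_of_dvd_pow ((hlp.dvd_or_dvd h3).resolve_left hln')
  rcases hlp.dvd_or_dvd h2 with h | h
  · have hu := (hlp.dvd_or_dvd h).resolve_left hl2
    exact ⟨hu, huv hu⟩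
  · refine ⟨?_, h⟩
    have : (l : ℤ) ∣ u ^ 2 := by
      have := dvd_add h1 (dvd_mul_of_dvd_right (dvd_pow h two_ne_zero) (n : ℤ))
      simpa using this
    exact hlp.dvd_of_dvd_pow this

/-- For l unramified, I² ⊆ (l) gives I ⊆ (l), so m ∈ I² ⊆ (l²), against m being square-free. -/
theorem dvd_two_mul_of_sq_eq_span (hn : Squarefree n) (h4 : n % 4 = 1) (hs : s ^ 2 = -(n : 𝓞 K))
    (hK : IntermediateField.adjoin ℚ {(s : K)} = ⊤) {m l : ℕ} (hm : Squarefree m) (hl : l.Prime)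
    (hlm : l ∣ m) {I : Ideal (𝓞 K)} (hI : I ^ 2 = Ideal.span {(m : 𝓞 K)}) : l ∣ 2 * n := by
  by_contra hln
  have hle : I ≤ Ideal.span {(l : 𝓞 K)} := by
    intro x hx
    refine mem_span_of_sq_mem hn h4 hs hK hl hln ?_
    have h1 : x ^ 2 ∈ Ideal.span {(m : 𝓞 K)} := hI ▸ Ideal.pow_mem_pow hx 2
    exact Ideal.span_singleton_le_span_singleton.2 (Nat.cast_dvd_cast hlm) h1
  have h2 := Ideal.pow_right_mono hle 2
  rw [hI, Ideal.span_singleton_pow, Ideal.span_singleton_le_iff_mem] at h2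
  have h3 := (mem_span_natCast hn h4 hs hK (m := l ^ 2) (u := m) (v := 0)).1 (by simpa using h2)
  have h4 : l * l ∣ m := by
    rw [← sq]
    exact_mod_cast h3.1
  exact hl.one_lt.ne' (Nat.isUnit_iff.1 (hm l h4))

/-- An explicit Hilbert 90. Let I² = (α) with α = u + vs of norm N². Then β = α + N satisfies β² =
2(u + N) α. Writing 2(u + N) = f²m with m square-free gives (β) = (f) I J with J² = (m), and [J] =
[I]⁻¹ = [I]. -/
theorem exists_sq_eq_span_of_sq_eq_one (hn : Squarefree n) (h4 : n % 4 = 1)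
    (hs : s ^ 2 = -(n : 𝓞 K)) (hK : IntermediateField.adjoin ℚ {(s : K)} = ⊤)
    {x : ClassGroup (𝓞 K)} (hx : x ^ 2 = 1) :
    ∃ (m : ℕ) (J : (Ideal (𝓞 K))⁰), Squarefree m ∧ ClassGroup.mk0 J = x ∧
      (J : Ideal (𝓞 K)) ^ 2 = Ideal.span {(m : 𝓞 K)} := by
  obtain ⟨I, hI⟩ := ClassGroup.mk0_surjective x
  have hI0 : (I : Ideal (𝓞 K)) ≠ 0 := nonZeroDivisors.ne_zero I.2
  have hN0 : 0 < Ideal.absNorm (I : Ideal (𝓞 K)) := Ideal.absNorm_pos_of_nonZeroDivisors I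
  set N := Ideal.absNorm (I : Ideal (𝓞 K)) with hN
  have hp : ((I ^ 2 : (Ideal (𝓞 K))⁰) : Ideal (𝓞 K)).IsPrincipal :=
    (ClassGroup.mk0_eq_one_iff (I ^ 2).2).1 (by rw [← hx, ← hI, ← map_pow])
  obtain ⟨α, hα⟩ := hp
  rw [SubmonoidClass.coe_pow, Ideal.submodule_span_eq] at hα
  -- From u² ≤ N² one has u ≥ -N. In the case u = -N, where β would vanish, α is replaced by -α.
  have hgen : ∃ u v : ℤ, (I : Ideal (𝓞 K)) ^ 2 = Ideal.span {(u : 𝓞 K) + v * s} ∧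
      0 < u + N ∧ (N : ℤ) ^ 2 = u ^ 2 + n * v ^ 2 := by
    obtain ⟨u, v, rfl⟩ := exists_int_coords hn h4 hs hK α
    have h1 : (N : ℤ) ^ 2 = u ^ 2 + n * v ^ 2 := by
      rw [← absNorm_span_coords hn h4 hs hK, ← hα, map_pow, ← hN]
      push_cast
      rfl
    have h2 : -(N : ℤ) ≤ u := by
      have : u ^ 2 ≤ (N : ℤ) ^ 2 := by
        rw [h1]
        have : 0 ≤ (n : ℤ) * v ^ 2 := by positivity
        omega
      exact (abs_le.1 (abs_le_of_sq_le_sq this (by positivity))).1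
    rcases h2.lt_or_eq with h3 | h3
    · exact ⟨u, v, hα, by omega, h1⟩
    · refine ⟨-u, -v, ?_, by omega, by rw [h1]; ring⟩
      rw [hα, ← Ideal.span_singleton_neg]
      congr 2
      push_cast
      ring
  obtain ⟨u, v, hα, hpos, hN2⟩ := hgen
  obtain ⟨M, hM⟩ : ∃ M : ℕ, (M : ℤ) = 2 * (u + N) := ⟨(2 * (u + N)).toNat, by omega⟩
  obtain ⟨m, f, hmf, hm⟩ := Nat.sq_mul_squarefree M
  have hM0 : M ≠ 0 := by omega
  have hf0 : f ≠ 0 := by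
    rintro rfl
    simp at hmf
    omega
  have hm0 : m ≠ 0 := hm.ne_zero
  have hMR : (f : 𝓞 K) ^ 2 * m = 2 * (u + N) := by
    have : ((f ^ 2 * m : ℕ) : ℤ) = 2 * (u + N) := by rw [hmf, hM]
    exact_mod_cast congrArg (Int.cast : ℤ → 𝓞 K) this
  have hN2R : (N : 𝓞 K) ^ 2 = u ^ 2 + n * v ^ 2 := by
    exact_mod_cast congrArg (Int.cast : ℤ → 𝓞 K) hN2
  set β : 𝓞 K := (u : 𝓞 K) + v * s + N with hβ
  have hβ2 : β ^ 2 = f ^ 2 * m * (u + v * s) := by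
    rw [hMR, hβ]
    linear_combination (v : 𝓞 K) ^ 2 * hs + hN2R
  have hspan : Ideal.span {β} ^ 2 =
      (Ideal.span {(f : 𝓞 K)} * I) ^ 2 * Ideal.span {(m : 𝓞 K)} := by
    rw [mul_pow, hα, Ideal.span_singleton_pow, Ideal.span_singleton_pow,
      Ideal.span_singleton_mul_span_singleton, Ideal.span_singleton_mul_span_singleton, hβ2]
    congr 2
    ring
  have hfI : Ideal.span {(f : 𝓞 K)} * (I : Ideal (𝓞 K)) ≠ 0 := by
    refine mul_ne_zero ?_ hI0
    rw [Ne, Ideal.zero_eq_bot, Ideal.span_singleton_eq_bot]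
    exact_mod_cast hf0
  have hmS : Ideal.span {(m : 𝓞 K)} ≠ 0 := by
    rw [Ne, Ideal.zero_eq_bot, Ideal.span_singleton_eq_bot]
    exact_mod_cast hm0
  have hβ0 : Ideal.span {β} ≠ 0 := by
    intro h
    rw [h, zero_pow two_ne_zero] at hspan
    exact mul_ne_zero (pow_ne_zero 2 hfI) hmS hspan.symm
  obtain ⟨J, hJ⟩ := ideal_dvd_of_sq_dvd_sq hβ0 (Dvd.intro _ hspan.symm)
  have hJ2 : J ^ 2 = Ideal.span {(m : 𝓞 K)} := by
    rw [hJ, mul_pow] at hspan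
    exact mul_left_cancel₀ (pow_ne_zero 2 hfI) hspan
  have hJ0 : J ≠ 0 := by
    rintro rfl
    exact hβ0 (by rw [hJ, mul_zero])
  have hfm : Ideal.span {(f : 𝓞 K)} ∈ (Ideal (𝓞 K))⁰ :=
    mem_nonZeroDivisors_of_ne_zero (left_ne_zero_of_mul hfI)
  refine ⟨m, ⟨J, mem_nonZeroDivisors_of_ne_zero hJ0⟩, hm, ?_, hJ2⟩
  have e1 : ClassGroup.mk0 (⟨Ideal.span {(f : 𝓞 K)}, hfm⟩ : (Ideal (𝓞 K))⁰) = 1 :=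
    mk0_eq_one_of_span rfl
  have e2 := mk0_mul_eq_one_of_span (x := β) (I := ⟨Ideal.span {(f : 𝓞 K)}, hfm⟩ * I)
    (J := ⟨J, mem_nonZeroDivisors_of_ne_zero hJ0⟩) (by rw [hJ]; rfl)
  rw [map_mul, e1, one_mul, hI] at e2
  rw [← inv_eq_of_mul_eq_one_right e2, inv_eq_iff_mul_eq_one, ← sq, hx]

/-- The ideals (q, t + s) and (q, t - s) have product (q), of norm q², and neither is the unit
ideal. -/
theorem exists_absNorm_eq_of_split (hn : Squarefree n) (h4 : n % 4 = 1)
    (hs : s ^ 2 = -(n : 𝓞 K)) (hK : IntermediateField.adjoin ℚ {(s : K)} = ⊤)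
    {q : ℕ} (hq : q.Prime) (hqn : q.Coprime (2 * n)) {t : ℤ} (ht : (q : ℤ) ∣ t ^ 2 + n) :
    ∃ I : Ideal (𝓞 K), Ideal.absNorm I = q := by
  have hqp : Prime (q : ℤ) := Nat.prime_iff_prime_int.1 hq
  have hq2n : ¬(q : ℤ) ∣ 2 * n := fun h =>
    (Nat.Prime.coprime_iff_not_dvd hq).1 hqn (by exact_mod_cast h)
  have hqt : ¬(q : ℤ) ∣ 2 * t := by
    intro h
    rcases hqp.dvd_or_dvd h with h | h
    · exact hq2n (dvd_mul_of_dvd_left h _)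
    · apply hq2n
      have := dvd_sub ht (dvd_pow h two_ne_zero)
      exact dvd_mul_of_dvd_right (by simpa using this) _
  obtain ⟨e, he⟩ := ht
  have hc : IsCoprime (q : ℤ) (2 * t) := (Prime.coprime_iff_not_dvd hqp).2 hqt
  obtain ⟨a, b, hab⟩ := hc
  have habR : (a * q + b * (2 * t) : 𝓞 K) = 1 := by
    exact_mod_cast congrArg (Int.cast : ℤ → 𝓞 K) hab
  have heR : (t ^ 2 + n : 𝓞 K) = q * e := by
    exact_mod_cast congrArg (Int.cast : ℤ → 𝓞 K) he
  set I : Ideal (𝓞 K) := Ideal.span {(q : 𝓞 K), (t : 𝓞 K) + s} with hI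
  set J : Ideal (𝓞 K) := Ideal.span {(q : 𝓞 K), (t : 𝓞 K) - s} with hJ
  have i1 : (q : 𝓞 K) ∈ I := Ideal.subset_span (by simp)
  have i2 : (t : 𝓞 K) + s ∈ I := Ideal.subset_span (by simp)
  have j1 : (q : 𝓞 K) ∈ J := Ideal.subset_span (by simp)
  have j2 : (t : 𝓞 K) - s ∈ J := Ideal.subset_span (by simp)
  have hIJ : I * J = Ideal.span {(q : 𝓞 K)} := by
    apply le_antisymm
    · rw [hI, hJ, Ideal.span_mul_span', Ideal.span_le]
      rintro _ ⟨x, hx, y, hy, rfl⟩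
      simp only [Set.mem_insert_iff, Set.mem_singleton_iff] at hx hy
      simp only [SetLike.mem_coe, Ideal.mem_span_singleton]
      rcases hx with rfl | rfl
      · exact dvd_mul_right _ _
      · rcases hy with rfl | rfl
        · exact dvd_mul_left _ _
        · exact ⟨e, by linear_combination heR - hs⟩
    · rw [Ideal.span_singleton_le_iff_mem]
      have e1 := Ideal.mul_mem_left _ (a : 𝓞 K) (Ideal.mul_mem_mul i1 j1)
      have e2 := Ideal.mul_mem_left _ (b : 𝓞 K) (Ideal.mul_mem_mul i1 j2)
      have e3 := Ideal.mul_mem_left _ (b : 𝓞 K) (Ideal.mul_mem_mul i2 j1)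
      convert Ideal.add_mem _ (Ideal.add_mem _ e1 e2) e3 using 1
      linear_combination (-(q : 𝓞 K)) * habR
  -- If one factor were trivial, the other would be (q) and contain t ± s, whose s-coordinate is a
  -- unit.
  have hnot : ∀ ε : ℤ, IsUnit ε → (t : 𝓞 K) + ε * s ∉ Ideal.span {(q : 𝓞 K)} := by
    intro ε hε h
    rw [mem_span_natCast hn h4 hs hK] at h
    exact hqp.not_isUnit (isUnit_of_dvd_unit h.2 hε)
  have hIne : I ≠ 1 := by
    intro h
    rw [h, one_mul] at hIJ
    exact hnot (-1) (by decide) (by rw [← hIJ]; simpa [sub_eq_add_neg] using j2)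
  have hJne : J ≠ 1 := by
    intro h
    rw [h, mul_one] at hIJ
    exact hnot 1 (by decide) (by rw [← hIJ]; simpa using i2)
  have hmul : Ideal.absNorm I * Ideal.absNorm J = q ^ 2 := by
    rw [← map_mul, hIJ, absNorm_span_natCast_eq_sq hn h4 hs hK]
  refine ⟨I, ?_⟩
  obtain ⟨i, hi2, hi⟩ := (Nat.dvd_prime_pow hq).1 (Dvd.intro _ hmul)
  interval_cases i
  · exact absurd ((Ideal.absNorm_eq_one_iff.1 (by rw [hi, pow_zero])).trans Ideal.one_eq_top.symm) hIne
  · simpa using hi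
  · rw [hi] at hmul
    have : Ideal.absNorm J = 1 :=
      Nat.eq_of_mul_eq_mul_left (pow_pos hq.pos 2) (by rw [hmul, mul_one])
    exact absurd ((Ideal.absNorm_eq_one_iff.1 this).trans Ideal.one_eq_top.symm) hJne

end Field

/-! ### Coprimality for primitive solutions -/

theorem mod_four_eq_one_of_prod {ι : Type*} (S : Finset ι) {p : ι → ℕ}
    (hp4 : ∀ i ∈ S, p i % 4 = 1) : (∏ i ∈ S, p i) % 4 = 1 :=
  Finset.prod_induction p (fun m => m % 4 = 1) (fun a b ha hb => by
    rw [Nat.mul_mod, ha, hb]) rfl hp4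

section Solution
variable {d e a b c w : ℕ}

/-- As p² does not divide de, p does not divide e, so p ∣ b; dividing the equation by p then yields
p ∣ a. -/
theorem prime_dvd_of_dvd_solution {p : ℕ} (hp : p.Prime) (hde : Squarefree (d * e))
    (h : w * c ^ 2 = d * a ^ 2 + e * b ^ 2) (hpd : p ∣ d) (hpc : p ∣ c) : p ∣ a ∧ p ∣ b := by
  obtain ⟨c, rfl⟩ := hpc
  obtain ⟨d, rfl⟩ := hpd
  have hpe : ¬p ∣ d * e := fun hd => by
    rw [mul_assoc] at hde
    exact hp.one_lt.ne' (Nat.isUnit_iff.1 (hde p (Nat.mul_dvd_mul_left p hd)))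
  have hb : p ∣ b := by
    have h1 : p ∣ e * b ^ 2 := by
      rw [← Nat.dvd_add_right (a := p) (b := p * d * a ^ 2) ⟨d * a ^ 2, by ring⟩, ← h]
      exact ⟨w * p * c ^ 2, by ring⟩
    exact hp.dvd_of_dvd_pow ((hp.dvd_mul.1 h1).resolve_left fun h =>
      hpe (dvd_mul_of_dvd_right h d))
  refine ⟨?_, hb⟩
  obtain ⟨b, rfl⟩ := hb
  have h1 : w * p * c ^ 2 = d * a ^ 2 + p * (e * b ^ 2) := by
    apply Nat.eq_of_mul_eq_mul_left hp.pos
    linear_combination h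
  have h2 : p ∣ d * a ^ 2 := by
    refine (Nat.dvd_add_left (dvd_mul_right p (e * b ^ 2))).1 ?_
    rw [← h1]
    exact ⟨w * c ^ 2, by ring⟩
  exact hp.dvd_of_dvd_pow ((hp.dvd_mul.1 h2).resolve_left fun h =>
    hpe (dvd_mul_of_dvd_left h e))

/-- Since de ≡ 1 mod 4, d ≡ e ≡ ±1 mod 4. An even c would give a² + b² ≡ 0 mod 4, so a and b would
be even too. -/
theorem odd_of_solution (hde : (d * e) % 4 = 1) (h : w * c ^ 2 = d * a ^ 2 + e * b ^ 2)
    (hg : Nat.gcd (Nat.gcd a b) c = 1) : ¬2 ∣ c := by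
  rintro ⟨c, rfl⟩
  have h4 : (d * a ^ 2 + e * b ^ 2) % 4 = 0 := by
    rw [← h]
    have : w * (2 * c) ^ 2 = 4 * (w * c ^ 2) := by ring
    omega
  have ha : a % 2 = 0 ∧ b % 2 = 0 := by
    rw [Nat.add_mod, Nat.mul_mod d, Nat.mul_mod e, Nat.pow_mod a, Nat.pow_mod b] at h4
    rw [Nat.mul_mod] at hde
    have ha4 : a % 4 < 4 := Nat.mod_lt _ (by norm_num)
    have hb4 : b % 4 < 4 := Nat.mod_lt _ (by norm_num)
    have hd4 : d % 4 < 4 := Nat.mod_lt _ (by norm_num)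
    have he4 : e % 4 < 4 := Nat.mod_lt _ (by norm_num)
    have ha2 : a % 2 = a % 4 % 2 := by omega
    have hb2 : b % 2 = b % 4 % 2 := by omega
    rw [ha2, hb2]
    generalize a % 4 = a at *
    generalize b % 4 = b at *
    generalize d % 4 = d at *
    generalize e % 4 = e at *
    clear h ha2 hb2 hg
    interval_cases d <;> interval_cases e <;> first | omega | skip
    all_goals interval_cases a <;> interval_cases b <;> simp_all
  have h2 : 2 ∣ Nat.gcd (Nat.gcd a b) (2 * c) :=
    Nat.dvd_gcd (Nat.dvd_gcd (by omega) (by omega)) (dvd_mul_right _ _)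
  omega

theorem coprime_of_solution (hde : (d * e) % 4 = 1) (hsq : Squarefree (d * e))
    (h : w * c ^ 2 = d * a ^ 2 + e * b ^ 2) (hg : Nat.gcd (Nat.gcd a b) c = 1) :
    c.Coprime (2 * (d * e)) := by
  refine Nat.Coprime.mul_right ?_ ?_
  · exact ((Nat.Prime.coprime_iff_not_dvd Nat.prime_two).2 (odd_of_solution hde h hg)).symm
  · refine Nat.Coprime.mul_right ?_ ?_ <;> refine Nat.Coprime.symm ?_ <;>
      refine Nat.coprime_of_dvd fun p hp hpd hpc => ?_
    · obtain ⟨ha, hb⟩ := prime_dvd_of_dvd_solution hp hsq h hpd hpc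
      exact hp.one_lt.ne' (Nat.dvd_one.1 (hg ▸ Nat.dvd_gcd (Nat.dvd_gcd ha hb) hpc))
    · obtain ⟨hb, ha⟩ := prime_dvd_of_dvd_solution hp (by rwa [mul_comm] at hsq)
        (by rw [h, add_comm]) hpd hpc
      exact hp.one_lt.ne' (Nat.dvd_one.1 (hg ▸ Nat.dvd_gcd (Nat.dvd_gcd ha hb) hpc))

/-- A prime dividing c does not divide 2de, so it would have to divide a and b. With n = de and β =
da + bs, the last two integers are the traces of β and of -sβ. -/
theorem bezout_of_solution (hc : c.Coprime (2 * (d * e))) (hg : Nat.gcd (Nat.gcd a b) c = 1) :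
    ∃ x y z : ℤ, x * c + y * (2 * (d * a)) + z * (2 * (b * (d * e))) = 1 := by
  obtain ⟨X, Y, hXY⟩ := Nat.isCoprime_iff_coprime.2
    (Nat.Coprime.mul_right hc (hc.coprime_dvd_right ⟨2 * e, by ring⟩ : c.Coprime d))
  obtain ⟨x, y, hxy⟩ := Nat.isCoprime_iff_coprime.2 hg
  have hab := Nat.gcd_eq_gcd_ab a b
  rw [hab] at hxy
  push_cast at hXY hxy
  refine ⟨y * X * c + x * (a * Nat.gcdA a b + b * Nat.gcdB a b) * X + y * (Y * (2 * (d * e) * d)),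
    x * Nat.gcdA a b * (Y * (d * e)), x * Nat.gcdB a b * (Y * d), ?_⟩
  linear_combination (X * c + Y * (2 * (d * e) * d)) * hxy + hXY

end Solution

/-! ### The ideal attached to a solution -/

section Field
variable {K : Type*} [Field K] [NumberField K] {n : ℕ} {s : 𝓞 K}

theorem absNorm_eq_of_sq_eq_span (hn : Squarefree n) (h4 : n % 4 = 1)
    (hs : s ^ 2 = -(n : 𝓞 K)) (hK : IntermediateField.adjoin ℚ {(s : K)} = ⊤) {m : ℕ}
    {I : Ideal (𝓞 K)} (hI : I ^ 2 = Ideal.span {(m : 𝓞 K)}) : Ideal.absNorm I = m := by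
  have := congrArg Ideal.absNorm hI
  rw [map_pow, absNorm_span_natCast_eq_sq hn h4 hs hK] at this
  exact Nat.pow_left_injective two_ne_zero this

theorem mem_nonZeroDivisors_of_sq_eq_span {m : ℕ} (hm : m ≠ 0) {I : Ideal (𝓞 K)}
    (hI : I ^ 2 = Ideal.span {(m : 𝓞 K)}) : I ∈ (Ideal (𝓞 K))⁰ := by
  refine mem_nonZeroDivisors_of_ne_zero ?_
  rintro rfl
  rw [zero_pow two_ne_zero, eq_comm, Ideal.zero_eq_bot, Ideal.span_singleton_eq_bot] at hI
  exact hm (by exact_mod_cast hI)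

/-- By `hu`, β = u + bs lies in 𝔡_m; by `hbez`, c, β and the conjugate β' generate the unit ideal.
Since ββ' = mc², the ideal J = (c, β) satisfies J² = (c², β), and 𝔡_m J² = (β). -/
theorem exists_ideal_of_norm_eq (hn : Squarefree n) (h4 : n % 4 = 1)
    (hs : s ^ 2 = -(n : 𝓞 K)) (hK : IntermediateField.adjoin ℚ {(s : K)} = ⊤) {m c : ℕ} {u b : ℤ}
    (hm : m ∣ 2 * n) (hm0 : m ≠ 0) (h : u ^ 2 + n * b ^ 2 = m * c ^ 2)
    (hu : (m : ℤ) ∣ u - b * n) (hcm : c.Coprime m)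
    (hbez : ∃ x y z : ℤ, x * c + y * (2 * u) + z * (2 * (b * n)) = 1) :
    ∃ J : Ideal (𝓞 K), Ideal.absNorm J = c ∧
      ramIdeal n s m * J ^ 2 = Ideal.span {(u : 𝓞 K) + b * s} := by
  have hD2 := ramIdeal_sq hs hn h4 hm
  set D := ramIdeal n s m with hD
  have d1 : (m : 𝓞 K) ∈ D := Ideal.subset_span (by simp)
  have d2 : (n : 𝓞 K) + s ∈ D := Ideal.subset_span (by simp)
  obtain ⟨e, he⟩ := hm
  obtain ⟨f, hf⟩ := hu
  obtain ⟨x, y, z, hxyz⟩ := hbez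
  obtain ⟨X, Y, hXY⟩ : IsCoprime ((c : ℤ) ^ 2) (m : ℤ) :=
    (Nat.isCoprime_iff_coprime.2 hcm).pow_left
  have hR : (u ^ 2 + n * b ^ 2 : 𝓞 K) = m * c ^ 2 := by
    exact_mod_cast congrArg (Int.cast : ℤ → 𝓞 K) h
  have heR : (2 * n : 𝓞 K) = m * e := by
    exact_mod_cast congrArg (Nat.cast : ℕ → 𝓞 K) he
  have hfR : (u - b * n : 𝓞 K) = m * f := by
    exact_mod_cast congrArg (Int.cast : ℤ → 𝓞 K) hf
  have hxR : (x * c + y * (2 * u) + z * (2 * (b * n)) : 𝓞 K) = 1 := by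
    exact_mod_cast congrArg (Int.cast : ℤ → 𝓞 K) hxyz
  have hXR : (X * c ^ 2 + Y * m : 𝓞 K) = 1 := by
    exact_mod_cast congrArg (Int.cast : ℤ → 𝓞 K) hXY
  set β : 𝓞 K := u + b * s with hβ
  set β' : 𝓞 K := u - b * s with hβ'
  have hββ : β * β' = m * c ^ 2 := by
    rw [← hR, hβ, hβ']
    linear_combination (-(b : 𝓞 K) ^ 2) * hs
  have hβD : β ∈ D := by
    convert Ideal.add_mem _ (Ideal.mul_mem_left _ (f : 𝓞 K) d1)
      (Ideal.mul_mem_left _ (b : 𝓞 K) d2) using 1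
    rw [hβ]
    linear_combination hfR
  have hβD' : β' ∈ D := by
    convert Ideal.sub_mem _ (Ideal.mul_mem_left _ (f + b * e : 𝓞 K) d1)
      (Ideal.mul_mem_left _ (b : 𝓞 K) d2) using 1
    rw [hβ']
    linear_combination hfR + b * heR
  -- Here 2u = β + β' and 2bn = s(β' - β), because s² = -n.
  have hone : (x : 𝓞 K) * c + (y - z * s) * β + (y + z * s) * β' = 1 := by
    rw [← hxR, hβ, hβ']
    linear_combination (-2 * z * b : 𝓞 K) * hs
  set J : Ideal (𝓞 K) := Ideal.span {(c : 𝓞 K), β} with hJ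
  have j1 : (c : 𝓞 K) ∈ J := Ideal.subset_span (by simp)
  have j2 : β ∈ J := Ideal.subset_span (by simp)
  have hJ2 : J ^ 2 = Ideal.span {(c : 𝓞 K) ^ 2, β} := by
    apply le_antisymm
    · rw [sq, hJ, Ideal.span_mul_span', Ideal.span_le]
      rintro _ ⟨v, hv, w, hw, rfl⟩
      simp only [Set.mem_insert_iff, Set.mem_singleton_iff] at hv hw
      have k1 : (c : 𝓞 K) ^ 2 ∈ Ideal.span {(c : 𝓞 K) ^ 2, β} := Ideal.subset_span (by simp)
      have k2 : β ∈ Ideal.span {(c : 𝓞 K) ^ 2, β} := Ideal.subset_span (by simp)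
      rcases hw with rfl | rfl
      · rcases hv with rfl | rfl
        · simpa [sq] using k1
        · exact Ideal.mul_mem_right _ _ k2
      · exact Ideal.mul_mem_left _ _ k2
    · rw [Ideal.span_le]
      rintro v hv
      simp only [Set.mem_insert_iff, Set.mem_singleton_iff] at hv
      rw [SetLike.mem_coe, sq]
      have c1 := Ideal.mul_mem_mul j1 j1
      rcases hv with rfl | rfl
      · rwa [sq]
      -- β times `hone`, with ββ' = mc², writes β as a combination of cβ, β² and c².
      · have e1 := Ideal.mul_mem_left _ (x : 𝓞 K) (Ideal.mul_mem_mul j1 j2)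
        have e2 := Ideal.mul_mem_left _ (y - z * s : 𝓞 K) (Ideal.mul_mem_mul j2 j2)
        have e3 := Ideal.mul_mem_left _ ((y + z * s) * m : 𝓞 K) c1
        convert Ideal.add_mem _ (Ideal.add_mem _ e1 e2) e3 using 1
        linear_combination (-β) * hone + (y + z * s) * hββ
  have hmain : D * J ^ 2 = Ideal.span {β} := by
    rw [hJ2]
    apply le_antisymm
    · rw [hD, ramIdeal, Ideal.span_mul_span', Ideal.span_le]
      rintro _ ⟨v, hv, w, hw, rfl⟩
      simp only [Set.mem_insert_iff, Set.mem_singleton_iff] at hv hw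
      rw [SetLike.mem_coe, Ideal.mem_span_singleton]
      rcases hw with rfl | rfl
      · rcases hv with rfl | rfl
        · exact ⟨β', by linear_combination -hββ⟩
        -- If (n + s)β' = mw, multiplying by β and cancelling m gives (n + s)c² = βw.
        · have h1 : ((n : 𝓞 K) + s) * β' ∈ D ^ 2 := by
            rw [sq]
            exact Ideal.mul_mem_mul d2 hβD'
          rw [hD2, Ideal.mem_span_singleton] at h1
          obtain ⟨w, hw⟩ := h1
          refine ⟨w, ?_⟩
          have hm0' : (m : 𝓞 K) ≠ 0 := by exact_mod_cast hm0
          apply mul_left_cancel₀ hm0'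
          linear_combination β * hw - (n + s) * hββ
      · exact dvd_mul_left _ _
    · rw [Ideal.span_singleton_le_iff_mem]
      have k1 : (c : 𝓞 K) ^ 2 ∈ Ideal.span {(c : 𝓞 K) ^ 2, β} := Ideal.subset_span (by simp)
      have k2 : β ∈ Ideal.span {(c : 𝓞 K) ^ 2, β} := Ideal.subset_span (by simp)
      have e1 := Ideal.mul_mem_left _ (X : 𝓞 K) (Ideal.mul_mem_mul hβD k1)
      have e2 := Ideal.mul_mem_left _ (Y : 𝓞 K) (Ideal.mul_mem_mul d1 k2)
      convert Ideal.add_mem _ e1 e2 using 1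
      linear_combination (-β) * hXR
  refine ⟨J, ?_, hmain⟩
  have hNorm := congrArg (fun L => (Ideal.absNorm L : ℤ)) hmain
  simp only [map_mul, map_pow] at hNorm
  rw [absNorm_eq_of_sq_eq_span hn h4 hs hK hD2, hβ, absNorm_span_coords hn h4 hs hK, h] at hNorm
  have : m * Ideal.absNorm J ^ 2 = m * c ^ 2 := by exact_mod_cast hNorm
  exact Nat.pow_left_injective two_ne_zero
    (Nat.eq_of_mul_eq_mul_left (Nat.pos_of_ne_zero hm0) this)

/-- Multiplying the equation by d gives (da)² + nb² = 2^r d c², so u = da and m = 2^r d are the data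
for `exists_ideal_of_norm_eq`. -/
theorem exists_ideal_of_solution (hn : Squarefree n) (h4 : n % 4 = 1)
    (hs : s ^ 2 = -(n : 𝓞 K)) (hK : IntermediateField.adjoin ℚ {(s : K)} = ⊤) {r d a b c : ℕ}
    (hr : r ≤ 1) (hd : d ∣ n) (h : IsPosPrimitiveSolution n r d a b c)
    (hD : ramIdeal n s (2 ^ r * d) ∈ (Ideal (𝓞 K))⁰) :
    c.Coprime n ∧ ∃ J : (Ideal (𝓞 K))⁰, Ideal.absNorm (J : Ideal (𝓞 K)) = c ∧
      ClassGroup.mk0 ⟨_, hD⟩ * ClassGroup.mk0 J ^ 2 = 1 := by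
  obtain ⟨ha, hb, hc, hg, heq⟩ := h
  obtain ⟨e, rfl⟩ := hd
  have hd0 : d ≠ 0 := by
    rintro rfl
    simp at h4
  rw [Nat.mul_div_cancel_left _ (Nat.pos_of_ne_zero hd0)] at heq
  have hcop := coprime_of_solution h4 hn heq hg
  have hm : 2 ^ r * d ∣ 2 * (d * e) := by
    rw [← mul_assoc]
    exact dvd_mul_of_dvd_left (Nat.mul_dvd_mul_right (by
      simpa using pow_dvd_pow 2 hr) d) e
  have heqZ : (2 : ℤ) ^ r * c ^ 2 = d * a ^ 2 + e * b ^ 2 := by exact_mod_cast heq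
  -- This gives m ∣ u - bn = d(a - be). For r = 1, d and e are odd and the equation forces a ≡ b mod
  -- 2.
  have hpar : (2 ^ r : ℤ) ∣ a - b * e := by
    interval_cases r
    · simp
    · have hdo : (d : ℤ) % 2 = 1 ∧ (e : ℤ) % 2 = 1 := by
        have : d * e % 2 = 1 := by omega
        have := Nat.odd_mul.1 (Nat.odd_iff.2 this)
        rw [Nat.odd_iff, Nat.odd_iff] at this
        omega
      have h2 : ((d : ℤ) * a ^ 2 + e * b ^ 2) % 2 = 0 := by rw [← heqZ]; simp
      rw [pow_one, Int.dvd_iff_emod_eq_zero]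
      rcases Int.emod_two_eq_zero_or_one a with ha | ha <;>
        rcases Int.emod_two_eq_zero_or_one b with hb | hb <;>
        simp [Int.add_emod, Int.sub_emod, Int.mul_emod, pow_two, ha, hb, hdo.1, hdo.2] at h2 ⊢
  obtain ⟨f, hf⟩ := hpar
  obtain ⟨x, y, z, hxyz⟩ := bezout_of_solution hcop hg
  obtain ⟨J, hJc, hJ⟩ := exists_ideal_of_norm_eq (m := 2 ^ r * d) (c := c) (u := d * a) (b := b)
    hn h4 hs hK hm (by positivity)
    (by push_cast; linear_combination (-(d : ℤ)) * heqZ)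
    ⟨f, by push_cast; linear_combination (d : ℤ) * hf⟩
    (hcop.coprime_dvd_right hm)
    ⟨x, y, z, by push_cast; exact hxyz⟩
  have hJ0 : J ∈ (Ideal (𝓞 K))⁰ :=
    Ideal.absNorm_ne_zero_iff_mem_nonZeroDivisors.1 (by rw [hJc]; exact hc.ne')
  refine ⟨hcop.coprime_dvd_right (dvd_mul_left _ _), ⟨J, hJ0⟩, hJc, ?_⟩
  rw [← map_pow]
  exact mk0_mul_eq_one_of_span hJ

theorem mk0_eq_mul_of_mul_eq {m₁ m₂ m g : ℕ} (hm : m₁ * m₂ = g ^ 2 * m) (hg : g ≠ 0)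
    {I₁ I₂ I : (Ideal (𝓞 K))⁰} (h₁ : (I₁ : Ideal (𝓞 K)) ^ 2 = Ideal.span {(m₁ : 𝓞 K)})
    (h₂ : (I₂ : Ideal (𝓞 K)) ^ 2 = Ideal.span {(m₂ : 𝓞 K)})
    (h : (I : Ideal (𝓞 K)) ^ 2 = Ideal.span {(m : 𝓞 K)}) :
    ClassGroup.mk0 I = ClassGroup.mk0 I₁ * ClassGroup.mk0 I₂ := by
  have hgm : Ideal.span {(g : 𝓞 K)} ∈ (Ideal (𝓞 K))⁰ := by
    refine mem_nonZeroDivisors_of_ne_zero ?_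
    rw [Ne, Ideal.zero_eq_bot, Ideal.span_singleton_eq_bot]
    exact_mod_cast hg
  have key : I₁ * I₂ = ⟨_, hgm⟩ * I := by
    apply Subtype.ext
    refine ideal_eq_of_sq_eq_sq (nonZeroDivisors.ne_zero (Subtype.mem _)) ?_
    rw [Submonoid.coe_mul, Submonoid.coe_mul, mul_pow, mul_pow, h₁, h₂, h,
      Ideal.span_singleton_pow, Ideal.span_singleton_mul_span_singleton,
      Ideal.span_singleton_mul_span_singleton]
    congr 2
    exact_mod_cast congrArg (Nat.cast : ℕ → 𝓞 K) hm
  rw [← map_mul, key, map_mul, mk0_eq_one_of_span (I := ⟨_, hgm⟩) rfl, one_mul]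

end Field

/-! ### Rédei matrix and ramified classes -/

theorem pStar_eq {p : ℕ} (h : p % 4 = 1) : pStar p = p := by
  have h2 : Even ((p - 1) / 2) := ⟨(p - 1) / 4, by omega⟩
  rw [pStar, h2.neg_one_pow, one_mul]

/-- On the diagonal D/p* = -4(n/p), and -1 and 4 are squares modulo p ≡ 1 mod 4, which leaves
[(n/p)/p], the value of the character at p itself. -/
theorem redeiMatrix_snoc_two_apply {n k : ℕ} {p : Fin k → ℕ} (hp : ∀ i, (p i).Prime)
    (hp4 : ∀ i, p i % 4 = 1) (hinj : Function.Injective p) (hpn : ∀ i, p i ∣ n)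
    (hn : Squarefree n) (i : Fin k) (j : Fin (k + 1)) :
    redeiMatrix (-4 * n) (Fin.snoc p 2 : Fin (k + 1) → ℕ) i j =
      genusChar n (p i) ((Fin.snoc p 2 : Fin (k + 1) → ℕ) j) := by
  have hpi := hp i
  have h4i := hp4 i
  rw [redeiMatrix, Matrix.of_apply, Fin.snoc_castSucc (α := fun _ => ℕ)]
  split_ifs with h
  · subst h
    rw [Fin.snoc_castSucc (α := fun _ => ℕ), genusChar_self hpi, pStar_eq h4i]
    obtain ⟨e, he⟩ := hpn i
    have hpe : ¬p i ∣ e := fun h =>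
      hpi.one_lt.ne' (Nat.isUnit_iff.1 (hn (p i) (by rw [he]; exact Nat.mul_dvd_mul_left _ h)))
    have hp0 : (p i : ℤ) ≠ 0 := by exact_mod_cast hpi.ne_zero
    have hodd : Odd (p i) := Nat.odd_iff.2 (by omega)
    have e1 : (-4 * n : ℤ) / p i = -1 * (2 ^ 2 * e) := by
      rw [he]
      push_cast
      rw [show (-4 * (p i * e) : ℤ) = p i * (-1 * (2 ^ 2 * e)) by ring]
      exact Int.mul_ediv_cancel_left _ hp0
    have h2 : (2 : ℤ).gcd (p i) = 1 := by
      have := Nat.coprime_two_left.2 hodd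
      simpa [Int.gcd] using this
    have h3 : (-1 : ℤ).gcd (p i) = 1 := by simp [Int.gcd]
    have h5 : addLegendre (-1) (p i) = 0 := by
      rw [addLegendre, jacobiSym.at_neg_one hodd, ZMod.χ₄_nat_one_mod_four h4i, if_pos rfl]
    have hge := gcd_natCast_eq_one hpi hpe
    have h6 : ((2 : ℤ) ^ 2).gcd (p i) = 1 := by
      rw [← Int.isCoprime_iff_gcd_eq_one] at h2 ⊢
      exact h2.pow_left
    have h7 : ((2 : ℤ) ^ 2 * e).gcd (p i) = 1 := by
      rw [← Int.isCoprime_iff_gcd_eq_one] at h6 hge ⊢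
      exact h6.mul_left hge
    rw [e1, addLegendre_mul h3 h7, addLegendre_mul h6 hge, addLegendre_sq h2, h5, zero_add,
      zero_add, he, Nat.mul_div_cancel_left _ hpi.pos]
  · symm
    apply genusChar_of_not_dvd
    induction j using Fin.lastCases with
    | last =>
      rw [Fin.snoc_last (α := fun _ => ℕ), Nat.prime_dvd_prime_iff_eq hpi Nat.prime_two]
      omega
    | cast j =>
      rw [Fin.snoc_castSucc (α := fun _ => ℕ), Nat.prime_dvd_prime_iff_eq hpi (hp j)]
      intro h'
      exact h (by rw [hinj h'])

section Genus
variable {K : Type*} [Field K] [NumberField K] {n : ℕ} {s : 𝓞 K}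
  {k : ℕ} {p : Fin k → ℕ} {P : Fin (k + 1) → (Ideal (𝓞 K))⁰}

theorem mk0_ramified_sq
    (hP : ∀ j, (P j : Ideal (𝓞 K)) ^ 2 =
      Ideal.span {(((Fin.snoc p 2 : Fin (k + 1) → ℕ) j : ℕ) : 𝓞 K)}) (j : Fin (k + 1)) :
    ClassGroup.mk0 (P j) ^ 2 = 1 := by
  rw [← map_pow]
  exact mk0_eq_one_of_span (by rw [SubmonoidClass.coe_pow, hP])

theorem exists_binaryProd_eq (hp : ∀ i, (p i).Prime) (hinj : Function.Injective p)
    (hp2 : ∀ i, p i ≠ 2) (hnp : n = ∏ i, p i) (hn : Squarefree n) (h4 : n % 4 = 1)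
    (hs : s ^ 2 = -(n : 𝓞 K)) (hK : IntermediateField.adjoin ℚ {(s : K)} = ⊤)
    (hP : ∀ j, (P j : Ideal (𝓞 K)) ^ 2 =
      Ideal.span {(((Fin.snoc p 2 : Fin (k + 1) → ℕ) j : ℕ) : 𝓞 K)})
    {x : ClassGroup (𝓞 K)} (hx : x ^ 2 = 1) :
    ∃ v : Fin (k + 1) → ZMod 2, binaryProd (fun j => ClassGroup.mk0 (P j)) v = x := by
  classical
  set q : Fin (k + 1) → ℕ := Fin.snoc p 2 with hq
  have hqp : ∀ j, (q j).Prime := fun j => by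
    induction j using Fin.lastCases with
    | last => simpa [q] using Nat.prime_two
    | cast j => simpa [q] using hp j
  have hqinj : Function.Injective q := Fin.snoc_injective_iff.2 ⟨hinj, fun ⟨i, hi⟩ => hp2 i hi⟩
  have hprod : ∏ j, q j = 2 * n := by
    rw [Fin.prod_univ_castSucc, hnp, mul_comm]
    simp [q]
  obtain ⟨m, J, hm, rfl, hJ⟩ := exists_sq_eq_span_of_sq_eq_one hn h4 hs hK hx
  -- Each prime factor of m divides 2n, so it is one of the q j.
  have hmS : m = ∏ j ∈ Finset.univ.filter (fun j => q j ∣ m), q j := by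
    rw [← Finset.prod_image (g := q) (f := fun l => l) (fun a _ b _ h => hqinj h)]
    conv_lhs => rw [← Nat.prod_primeFactors_of_squarefree hm]
    refine Finset.prod_congr ?_ fun _ _ => rfl
    ext l
    rw [Finset.mem_image, Nat.mem_primeFactors]
    constructor
    · rintro ⟨hl, hlm, -⟩
      have h1 := dvd_two_mul_of_sq_eq_span hn h4 hs hK hm hl hlm hJ
      rw [← hprod, hl.prime.dvd_finsetProd_iff] at h1
      obtain ⟨j, -, hj⟩ := h1
      have := (Nat.prime_dvd_prime_iff_eq hl (hqp j)).1 hj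
      exact ⟨j, by simp [← this, hlm], this.symm⟩
    · rintro ⟨j, hj, rfl⟩
      exact ⟨hqp j, (Finset.mem_filter.1 hj).2, hm.ne_zero⟩
  refine ⟨_, (mk0_eq_binaryProd (q := fun j => ((q j : ℕ) : 𝓞 K)) hP
    (S := Finset.univ.filter (fun j => q j ∣ m)) ?_).symm⟩
  rw [hJ]
  congr 2
  exact_mod_cast congrArg (Nat.cast : ℕ → 𝓞 K) hmS

/-- For k > 0 the relation is (s)² = (n), which involves every odd ramified prime. For k = 0, n = 1
and index 0 is the prime 2, with (1 + s)² = 2s and s a unit. -/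
theorem exists_binaryProd_relation (hn0 : 0 < n) (hnp : n = ∏ i, p i) (hs : s ^ 2 = -(n : 𝓞 K))
    (hP : ∀ j, (P j : Ideal (𝓞 K)) ^ 2 =
      Ideal.span {(((Fin.snoc p 2 : Fin (k + 1) → ℕ) j : ℕ) : 𝓞 K)}) :
    ∃ e : Fin (k + 1) → ZMod 2, e 0 = 1 ∧ binaryProd (fun j => ClassGroup.mk0 (P j)) e = 1 := by
  classical
  have key : ∃ (S : Finset (Fin (k + 1))) (γ : 𝓞 K), 0 ∈ S ∧ γ ≠ 0 ∧ Ideal.span {γ} ^ 2 =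
      Ideal.span {∏ j ∈ S, (((Fin.snoc p 2 : Fin (k + 1) → ℕ) j : ℕ) : 𝓞 K)} := by
    rcases k with _ | k
    · have hn1 : n = 1 := by simpa using hnp
      have hs1 : s ^ 2 = -1 := by simpa [hn1] using hs
      have hu : IsUnit s := IsUnit.of_mul_eq_one (-s) (by linear_combination -hs1)
      have h2 : (1 + s) ^ 2 = 2 * s := by linear_combination hs1
      refine ⟨{0}, 1 + s, by simp, ?_, ?_⟩
      · intro h
        rw [h, zero_pow two_ne_zero, eq_comm] at h2
        exact mul_ne_zero two_ne_zero hu.ne_zero h2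
      · rw [Ideal.span_singleton_pow, h2, Ideal.span_singleton_mul_right_unit hu,
          Finset.prod_singleton]
        rfl
    · refine ⟨Finset.univ.map Fin.castSuccEmb, s, ?_, ?_, ?_⟩
      · rw [Finset.mem_map]
        exact ⟨0, Finset.mem_univ _, rfl⟩
      · rintro rfl
        rw [zero_pow two_ne_zero, eq_comm, neg_eq_zero] at hs
        exact hn0.ne' (by exact_mod_cast hs)
      · rw [Finset.prod_map, Ideal.span_singleton_pow, hs, Ideal.span_singleton_neg, hnp]
        simp
  obtain ⟨S, γ, h0, hγ, hS⟩ := key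
  have hγm : Ideal.span {γ} ∈ (Ideal (𝓞 K))⁰ := by
    refine mem_nonZeroDivisors_of_ne_zero ?_
    rwa [Ne, Ideal.zero_eq_bot, Ideal.span_singleton_eq_bot]
  refine ⟨fun j => if j ∈ S then 1 else 0, if_pos h0, ?_⟩
  rw [← mk0_eq_binaryProd (I := ⟨_, hγm⟩) hP hS]
  exact mk0_eq_one_of_span rfl

end Genus

/-! ### Fourth powers through the genus map -/

theorem genus_hom_surjective {K : Type*} [Field K] [NumberField K] {n k : ℕ} {s : 𝓞 K}
    {p : Fin k → ℕ} (hp : ∀ i, (p i).Prime) (hp4 : ∀ i, p i % 4 = 1) (hnp : n = ∏ i, p i)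
    (hn : Squarefree n) (hs : s ^ 2 = -(n : 𝓞 K))
    (hK : IntermediateField.adjoin ℚ {(s : K)} = ⊤)
    {g : ClassGroup (𝓞 K) →* Multiplicative (Fin k → ZMod 2)}
    (hg : ∀ (I : (Ideal (𝓞 K))⁰) (i : Fin k), (g (ClassGroup.mk0 I)).toAdd i =
      genusChar n (p i) (Ideal.absNorm (I : Ideal (𝓞 K)))) : Function.Surjective g := by
  subst hnp
  have h4 := mod_four_eq_one_of_prod Finset.univ fun i _ => hp4 i
  intro ε
  obtain ⟨q, hq, hqn, hqε, t, ht⟩ := exists_prime_of_symbols hp hp4 hn h4 ε.toAdd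
  obtain ⟨I, hI⟩ := exists_absNorm_eq_of_split hn h4 hs hK hq hqn ht
  refine ⟨ClassGroup.mk0 ⟨I, Ideal.absNorm_ne_zero_iff_mem_nonZeroDivisors.1
    (hI ▸ hq.ne_zero)⟩, Multiplicative.toAdd.injective (funext fun i => ?_)⟩
  rw [hg, hI, genusChar_of_not_dvd, hqε]
  rw [← Nat.Prime.coprime_iff_not_dvd (hp i)]
  exact (hqn.coprime_dvd_right (dvd_mul_of_dvd_right
    (Finset.dvd_prod_of_mem p (Finset.mem_univ i)) 2)).symm

theorem genus_hom_binaryProd {A : Type*} [CommGroup A] {k : ℕ} {ι : Type*} [Fintype ι]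
    (g : A →* Multiplicative (Fin k → ZMod 2)) {c : ι → A} {R : Matrix (Fin k) ι (ZMod 2)}
    (hR : ∀ i j, R i j = (g (c j)).toAdd i) (v : ι → ZMod 2) :
    (g (binaryProd c v)).toAdd = R.mulVec v := by
  rw [binaryProd, map_prod, toAdd_prod]
  ext i
  rw [Finset.sum_apply, Matrix.mulVec, dotProduct]
  refine Finset.sum_congr rfl fun j _ => ?_
  rw [map_pow, toAdd_pow, Pi.smul_apply, nsmul_eq_mul, ZMod.natCast_zmod_val, hR, mul_comm]

/-- Since D = γ⁻², D = x⁴ exactly when γx² is 2-torsion. As ker g consists of squares, such an x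
exists exactly when g(γ) is the image of a 2-torsion element, that is, when it lies in the range of
R. -/
theorem exists_pow_four_iff {A : Type*} [CommGroup A] {k : ℕ} {ι : Type*} [Fintype ι]
    {g : A →* Multiplicative (Fin k → ZMod 2)} {c : ι → A} {R : Matrix (Fin k) ι (ZMod 2)}
    (hc : ∀ j, c j ^ 2 = 1) (hR : ∀ i j, R i j = (g (c j)).toAdd i)
    (htors : ∀ x : A, x ^ 2 = 1 → ∃ v, binaryProd c v = x)
    (hker : ∀ x : A, g x = 1 → ∃ y, x = y ^ 2) {D γ : A} (hD : D * γ ^ 2 = 1) :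
    (∃ x, D = x ^ 4) ↔ (g γ).toAdd ∈ LinearMap.range R.mulVecLin := by
  have hg2 : ∀ x, g x ^ 2 = 1 := fun x =>
    Multiplicative.toAdd.injective (funext fun i => CharTwo.two_nsmul _)
  constructor
  · rintro ⟨x, rfl⟩
    obtain ⟨v, hv⟩ := htors (γ * x ^ 2) (by rw [← hD, mul_pow, ← pow_mul, mul_comm])
    refine ⟨v, ?_⟩
    rw [Matrix.mulVecLin_apply, ← genus_hom_binaryProd g hR, hv, map_mul, map_pow, hg2, mul_one]
  · rintro ⟨v, hv⟩
    rw [Matrix.mulVecLin_apply, ← genus_hom_binaryProd g hR] at hv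
    have hv' : g (binaryProd c v) = g γ := hv
    obtain ⟨y, hy⟩ := hker (γ * binaryProd c v) (by rw [map_mul, hv', ← sq, hg2])
    refine ⟨y⁻¹, ?_⟩
    -- The 2-torsion factor of y² disappears on squaring.
    have h4 : γ ^ 2 = y ^ 4 := by
      rw [show 4 = 2 * 2 from rfl, pow_mul, ← hy, mul_pow, binaryProd_sq hc, mul_one]
    rw [inv_pow, ← h4]
    exact eq_inv_of_mul_eq_one_left hD

theorem exists_odot_eq {m₁ m₂ : ℕ} (h₁ : m₁ ≠ 0) :
    ∃ g, g ≠ 0 ∧ m₁ * m₂ = g ^ 2 * odot m₁ m₂ :=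
  ⟨Nat.gcd m₁ m₂, Nat.gcd_ne_zero_left h₁, (Nat.mul_div_cancel' (by
    rw [sq]
    exact Nat.mul_dvd_mul (Nat.gcd_dvd_left _ _) (Nat.gcd_dvd_right _ _))).symm⟩

end RedeiClass

/-! ### The criterion -/

open RedeiClass in
theorem proposition3p5 {K : Type*} [Field K] [NumberField K]
    {k : ℕ} (n : ℕ) (p : Fin k → ℕ)
    (hp : ∀ i, (p i).Prime) (hp4 : ∀ i, p i % 4 = 1)
    (hn : n = ∏ i, p i) (hsq : Squarefree n)
    (s : NumberField.RingOfIntegers K) (hs : s ^ 2 = -(n : NumberField.RingOfIntegers K))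
    (hK : IntermediateField.adjoin ℚ {(s : K)} = ⊤)
    (r₁ r₂ r d₁ d₂ d : ℕ) (hr₁ : r₁ ≤ 1) (hr₂ : r₂ ≤ 1) (hr : r ≤ 1)
    (hd₁ : d₁ ∣ n) (hd₂ : d₂ ∣ n) (hd : d ∣ n)
    (hD₁ : 2 ^ r₁ * d₁ ∈ RedeiClass.sqfreeDivisors (NumberField.discr K))
    (hD₂ : 2 ^ r₂ * d₂ ∈ RedeiClass.sqfreeDivisors (NumberField.discr K))
    (hN₁ : RedeiClass.IsFieldNorm K (2 ^ r₁ * d₁))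
    (hN₂ : RedeiClass.IsFieldNorm K (2 ^ r₂ * d₂))
    (hdot : 2 ^ r * d = RedeiClass.odot (2 ^ r₁ * d₁) (2 ^ r₂ * d₂))
    (a₁ b₁ c₁ a₂ b₂ c₂ : ℕ)
    (h₁ : RedeiClass.IsPosPrimitiveSolution n r₁ d₁ a₁ b₁ c₁)
    (h₂ : RedeiClass.IsPosPrimitiveSolution n r₂ d₂ a₂ b₂ c₂)
    (C₁ C₂ : Fin k → ZMod 2)
    (hC₁ : ∀ i, C₁ i = RedeiClass.addLegendre (c₁ : ℤ) (p i))
    (hC₂ : ∀ i, C₂ i = RedeiClass.addLegendre (c₂ : ℤ) (p i)) :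
    RedeiClass.ClassMemFour (RedeiClass.ramIdeal n s (2 ^ r * d)) ↔
      C₁ + C₂ ∈ LinearMap.range (Matrix.mulVecLin
        (RedeiClass.redeiMatrix (NumberField.discr K) (Fin.snoc p 2 : Fin (k + 1) → ℕ))) := by
  have h4 : n % 4 = 1 := hn ▸ mod_four_eq_one_of_prod Finset.univ fun i _ => hp4 i
  have hn0 : 0 < n := by omega
  have hpn : ∀ i, p i ∣ n := fun i => hn ▸ Finset.dvd_prod_of_mem p (Finset.mem_univ i)
  have hinj : Function.Injective p := by
    intro i j hij
    by_contra hne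
    have h := coprime_of_squarefree_prod (hn ▸ hsq) hne
    rw [hij, Nat.coprime_self] at h
    exact (hp j).ne_one h
  have hp2 : ∀ i, p i ≠ 2 := fun i h => by have := hp4 i; omega
  have hdvd : ∀ {r d : ℕ}, r ≤ 1 → d ∣ n → 2 ^ r * d ∣ 2 * n := fun hr hd =>
    Nat.mul_dvd_mul (by simpa using pow_dvd_pow 2 hr) hd
  have hq : ∀ j, (Fin.snoc p 2 : Fin (k + 1) → ℕ) j ∣ 2 * n := fun j => by
    induction j using Fin.lastCases with
    | last => simp
    | cast j => simpa using dvd_mul_of_dvd_right (hpn j) 2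
  have hne : ∀ {m : ℕ}, m ∣ 2 * n → m ≠ 0 := fun h h' => by
    rw [h', zero_dvd_iff] at h
    omega
  have hmem : ∀ {m : ℕ}, m ∣ 2 * n → ramIdeal n s m ∈ (Ideal (𝓞 K))⁰ := fun h =>
    mem_nonZeroDivisors_of_sq_eq_span (hne h) (ramIdeal_sq hs hsq h4 h)
  set P : Fin (k + 1) → (Ideal (𝓞 K))⁰ := fun j => ⟨_, hmem (hq j)⟩ with hPdef
  have hP : ∀ j, (P j : Ideal (𝓞 K)) ^ 2 =
      Ideal.span {(((Fin.snoc p 2 : Fin (k + 1) → ℕ) j : ℕ) : 𝓞 K)} := fun j =>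
    ramIdeal_sq hs hsq h4 (hq j)
  obtain ⟨g, hg⟩ := exists_genus_hom hp hpn hsq h4 hs hK
  have hc := mk0_ramified_sq hP
  have htors := fun x => exists_binaryProd_eq hp hinj hp2 hn hsq h4 hs hK hP (x := x)
  obtain ⟨e, he0, he⟩ := exists_binaryProd_relation hn0 hn hs hP
  have hker := fun x => exists_sq_of_mem_ker (genus_hom_surjective hp hp4 hn hsq hs hK hg)
    (card_two_torsion_le hc he0 he htors) (x := x)
  have hR : ∀ i j, redeiMatrix (discr K) (Fin.snoc p 2 : Fin (k + 1) → ℕ) i j =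
      (g (ClassGroup.mk0 (P j))).toAdd i := fun i j => by
    rw [discr_eq hsq h4 hs hK, redeiMatrix_snoc_two_apply hp hp4 hinj hpn hsq, hg,
      absNorm_eq_of_sq_eq_span hsq h4 hs hK (hP j)]
  obtain ⟨hc₁, J₁, hJ₁, hγ₁⟩ := exists_ideal_of_solution hsq h4 hs hK hr₁ hd₁ h₁ (hmem (hdvd hr₁ hd₁))
  obtain ⟨hc₂, J₂, hJ₂, hγ₂⟩ := exists_ideal_of_solution hsq h4 hs hK hr₂ hd₂ h₂ (hmem (hdvd hr₂ hd₂))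
  obtain ⟨f, hf0, hf⟩ := exists_odot_eq (m₂ := 2 ^ r₂ * d₂) (hne (hdvd hr₁ hd₁))
  rw [← hdot] at hf
  have hD := mk0_eq_mul_of_mul_eq hf hf0 (I₁ := ⟨_, hmem (hdvd hr₁ hd₁)⟩)
    (I₂ := ⟨_, hmem (hdvd hr₂ hd₂)⟩) (I := ⟨_, hmem (hdvd hr hd)⟩)
    (ramIdeal_sq hs hsq h4 (hdvd hr₁ hd₁)) (ramIdeal_sq hs hsq h4 (hdvd hr₂ hd₂))
    (ramIdeal_sq hs hsq h4 (hdvd hr hd))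
  -- Up to a principal ideal, 𝔡 for the ⊙-product is the product of the two 𝔡's, so the relations
  -- for J₁ and J₂ multiply.
  have hγ : ClassGroup.mk0 ⟨_, hmem (hdvd hr hd)⟩ *
      (ClassGroup.mk0 J₁ * ClassGroup.mk0 J₂) ^ 2 = 1 := by
    rw [hD, mul_pow, mul_mul_mul_comm, hγ₁, hγ₂, one_mul]
  -- Each c_i is prime to n, so its genus characters are plain Legendre symbols.
  have hsymb : ∀ {c : ℕ} (i : Fin k), c.Coprime n → genusChar n (p i) c = addLegendre c (p i) :=
    fun i h => genusChar_of_not_dvd ((Nat.Prime.coprime_iff_not_dvd (hp i)).1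
      (h.coprime_dvd_right (hpn i)).symm)
  have hC : (g (ClassGroup.mk0 J₁ * ClassGroup.mk0 J₂)).toAdd = C₁ + C₂ := by
    ext i
    rw [map_mul, toAdd_mul, Pi.add_apply, Pi.add_apply, hg, hg, hJ₁, hJ₂, hsymb i hc₁, hsymb i hc₂,
      hC₁, hC₂]
  rw [← hC, ← exists_pow_four_iff hc hR htors hker hγ]
  exact ⟨fun ⟨_, hx⟩ => hx, fun hx => ⟨_, hx⟩⟩
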